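/- Let $d\ge 1$, let $\mathbb{M}$ be the Euclidean space $\mathbb{E}^d$ or the hyperbolic space $\mathbb{H}^d$ (of curvature $-1$), and let $B\subset\mathbb{M}$ be a closed ball of positive radius. A simplex in $\mathbb{M}$ means the convex hull of $d+1$ points that has nonempty interior; it is circumscribed about $B$ if it contains $B$ and each of its facets meets (i.e. touches) $B$; it is regular if every permutation of its vertices is induced by an isometry of $\mathbb{M}$. Then, among the simplices containing $B$, the ones with minimal volume are exactly the regular simplices circumscribed about $B$: a simplex $S$ contains $B$ and satisfies $\mathrm{vol}_d(S)\le \mathrm{vol}_d(T)$ for every simplex $T$ containing $B$ if and only if $S$ is regular and circumscribed about $B$. Moreover, a simplex of minimal volume containing $B$ exists whenever some simplex contains $B$ (which is always the case if $\mathbb{M}=\mathbb{E}^d$, but not always in $\mathbb{H}^d$). -/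

import Mathlib

open MeasureTheory

open scoped RealInnerProductSpace ENNReal

/-! ### Convexity, simplices and balls in a uniquely geodesic metric space -/

section Geometry

variable {M : Type*} [MetricSpace M]

/-- The closed segment with endpoints `p` and `q`: the points lying on a shortest curve
from `p` to `q`. -/
def geodesicSegment (p q : M) : Set M :=
  {x | dist p x + dist x q = dist p q}

/-- A set is convex if it contains the segment between any two of its points. -/
def IsGeodesicallyConvex (K : Set M) : Prop :=
  ∀ p ∈ K, ∀ q ∈ K, geodesicSegment p q ⊆ K

/-- The convex hull: the intersection of all convex sets containing `X`. -/
def geodesicHull (X : Set M) : Set M :=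
  ⋂₀ {K | IsGeodesicallyConvex K ∧ X ⊆ K}

/-- The convex hull of the vertices `p 0, …, p n`. -/
def simplexBody {n : ℕ} (p : Fin (n + 1) → M) : Set M :=
  geodesicHull (Set.range p)

/-- The points `p 0, …, p n` of an `n`-dimensional space `M` are the vertices of a
(nondegenerate) `n`-dimensional simplex: their convex hull has interior points. -/
def IsSimplex {n : ℕ} (p : Fin (n + 1) → M) : Prop :=
  (interior (simplexBody p)).Nonempty

/-- The facet opposite to the vertex `p i`. -/
def simplexFacet {n : ℕ} (p : Fin (n + 1) → M) (i : Fin (n + 1)) : Set M :=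
  geodesicHull (p '' {j | j ≠ i})

/-- A simplex is regular if every permutation of its vertices is induced by an isometry of the
whole space (compare `Affine.Simplex.Regular`). -/
def IsRegularSimplex {n : ℕ} (p : Fin (n + 1) → M) : Prop :=
  IsSimplex p ∧ ∀ σ : Equiv.Perm (Fin (n + 1)), ∃ f : M ≃ᵢ M, ∀ i, f (p i) = p (σ i)

/-- The simplex with vertices `p` is circumscribed about `B`: it contains `B`, and `B` touches
each of its facets. -/
def IsCircumscribedAbout {n : ℕ} (p : Fin (n + 1) → M) (B : Set M) : Prop :=
  B ⊆ simplexBody p ∧ ∀ i, (simplexFacet p i ∩ B).Nonempty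

/-- `p` spans a simplex which contains `B` and has the smallest volume among all simplices
containing `B`. -/
def IsMinVolSimplexContaining [MeasurableSpace M] (μ : Measure M) {n : ℕ}
    (p : Fin (n + 1) → M) (B : Set M) : Prop :=
  IsSimplex p ∧ B ⊆ simplexBody p ∧
    ∀ q : Fin (n + 1) → M, IsSimplex q → B ⊆ simplexBody q →
      μ (simplexBody p) ≤ μ (simplexBody q)

end Geometry

/-! ### Hyperbolic space in the projective ball model -/

/-- Hyperbolic `d`-space (of curvature `-1`) in the projective (Beltrami–Klein) ball model:
the points are the points of the open unit ball of Euclidean `d`-space. -/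
@[ext]
structure HypSpace (d : ℕ) where
  coords : EuclideanSpace ℝ (Fin d)
  norm_coords_lt_one : ‖coords‖ < 1

namespace HypSpace

variable {d : ℕ}

/-- The hyperbolic cosine of the hyperbolic distance of two points of the model. -/
noncomputable def coshDist (x y : HypSpace d) : ℝ :=
  (1 - ⟪x.coords, y.coords⟫) / (√(1 - ‖x.coords‖ ^ 2) * √(1 - ‖y.coords‖ ^ 2))

/-- The hyperbolic distance. -/
noncomputable instance : Dist (HypSpace d) where
  dist x y := Real.arcosh (coshDist x y)

theorem dist_def (x y : HypSpace d) : dist x y = Real.arcosh (coshDist x y) := rfl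

theorem one_sub_norm_sq_pos (x : HypSpace d) : 0 < 1 - ‖x.coords‖ ^ 2 := by
  have h := x.norm_coords_lt_one
  have h0 := norm_nonneg x.coords
  nlinarith

theorem one_sub_inner_pos (x y : HypSpace d) : 0 < 1 - ⟪x.coords, y.coords⟫ := by
  have h := real_inner_le_norm x.coords y.coords
  have hx := x.norm_coords_lt_one
  have hy := y.norm_coords_lt_one
  nlinarith [norm_nonneg x.coords, norm_nonneg y.coords]

theorem coshDist_comm (x y : HypSpace d) : coshDist x y = coshDist y x := by
  rw [coshDist, coshDist, real_inner_comm, mul_comm (√(1 - ‖x.coords‖ ^ 2))]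

theorem coshDist_self (x : HypSpace d) : coshDist x x = 1 := by
  have h := one_sub_norm_sq_pos x
  rw [coshDist, Real.mul_self_sqrt h.le, real_inner_self_eq_norm_sq, div_self h.ne']

/-- The reverse Cauchy–Schwarz inequality, with a quantitative error term. -/
theorem gap_le (x y : HypSpace d) :
    (1 - ‖x.coords‖ ^ 2) * ‖x.coords - y.coords‖ ^ 2 ≤
      (1 - ⟪x.coords, y.coords⟫) ^ 2 - (1 - ‖x.coords‖ ^ 2) * (1 - ‖y.coords‖ ^ 2) := by
  have h1 := norm_sub_sq_real x.coords y.coords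
  have h2 := real_inner_mul_inner_self_le x.coords (x.coords - y.coords)
  rw [inner_sub_right, real_inner_self_eq_norm_sq, real_inner_self_eq_norm_sq] at h2
  rw [h1] at h2 ⊢
  nlinarith

theorem one_le_coshDist (x y : HypSpace d) : 1 ≤ coshDist x y := by
  have hx := one_sub_norm_sq_pos x
  have hy := one_sub_norm_sq_pos y
  have h := gap_le x y
  have h0 : 0 ≤ (1 - ‖x.coords‖ ^ 2) * ‖x.coords - y.coords‖ ^ 2 := by positivity
  rw [coshDist, ← Real.sqrt_mul hx.le, le_div_iff₀ (by positivity), one_mul]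
  exact Real.sqrt_le_iff.2 ⟨(one_sub_inner_pos x y).le, by linarith⟩

theorem eq_of_coshDist_eq_one {x y : HypSpace d} (h : coshDist x y = 1) : x = y := by
  have hx := one_sub_norm_sq_pos x
  have hy := one_sub_norm_sq_pos y
  have hg := gap_le x y
  rw [coshDist, ← Real.sqrt_mul hx.le, div_eq_one_iff_eq (by positivity)] at h
  rw [h, Real.sq_sqrt (by positivity), sub_self] at hg
  have h2 : ‖x.coords - y.coords‖ ^ 2 ≤ 0 := by
    by_contra hc
    push Not at hc
    nlinarith [mul_pos hx hc]
  have h3 : ‖x.coords - y.coords‖ = 0 := by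
    have := norm_nonneg (x.coords - y.coords)
    nlinarith
  exact HypSpace.ext (sub_eq_zero.1 (norm_eq_zero.1 h3))

/-- Cauchy–Schwarz for the positive form `⟪s, t⟫ - ⟪s, y⟫ ⟪t, y⟫`, where `‖y‖ < 1`. -/
theorem form_cauchy_schwarz (y : HypSpace d) (s t : EuclideanSpace ℝ (Fin d)) :
    (⟪s, t⟫ - ⟪s, y.coords⟫ * ⟪t, y.coords⟫) ^ 2 ≤
      (‖s‖ ^ 2 - ⟪s, y.coords⟫ ^ 2) * (‖t‖ ^ 2 - ⟪t, y.coords⟫ ^ 2) := by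
  have hpos : ∀ w : EuclideanSpace ℝ (Fin d), 0 ≤ ‖w‖ ^ 2 - ⟪w, y.coords⟫ ^ 2 := by
    intro w
    have h := real_inner_mul_inner_self_le w y.coords
    rw [real_inner_self_eq_norm_sq, real_inner_self_eq_norm_sq] at h
    nlinarith [one_sub_norm_sq_pos y, sq_nonneg ‖w‖]
  have hd := discrim_le_zero (a := ‖s‖ ^ 2 - ⟪s, y.coords⟫ ^ 2)
    (b := 2 * (⟪s, t⟫ - ⟪s, y.coords⟫ * ⟪t, y.coords⟫))
    (c := ‖t‖ ^ 2 - ⟪t, y.coords⟫ ^ 2) (fun k => by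
      have h := hpos (k • s + t)
      rw [norm_add_sq_real, norm_smul, inner_add_left, real_inner_smul_left,
        real_inner_smul_left, mul_pow, Real.norm_eq_abs, sq_abs] at h
      nlinarith)
  rw [discrim] at hd
  nlinarith

theorem coshDist_triangle (x y z : HypSpace d) :
    coshDist x z ≤ coshDist x y * coshDist y z +
      √(coshDist x y ^ 2 - 1) * √(coshDist y z ^ 2 - 1) := by
  have ha := one_sub_norm_sq_pos x
  have hb := one_sub_norm_sq_pos y
  have hc := one_sub_norm_sq_pos z
  have hxy := one_le_coshDist x y
  have hyz := one_le_coshDist y z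
  have hA : coshDist x y * (√(1 - ‖x.coords‖ ^ 2) * √(1 - ‖y.coords‖ ^ 2)) =
      1 - ⟪x.coords, y.coords⟫ := by rw [coshDist]; field_simp
  have hB : coshDist y z * (√(1 - ‖y.coords‖ ^ 2) * √(1 - ‖z.coords‖ ^ 2)) =
      1 - ⟪y.coords, z.coords⟫ := by rw [coshDist]; field_simp
  have hC : coshDist x z * (√(1 - ‖x.coords‖ ^ 2) * √(1 - ‖z.coords‖ ^ 2)) =
      1 - ⟪x.coords, z.coords⟫ := by rw [coshDist]; field_simp
  have ha2 := Real.sq_sqrt ha.le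
  have hb2 := Real.sq_sqrt hb.le
  have hc2 := Real.sq_sqrt hc.le
  have ha0 := Real.sqrt_pos.2 ha
  have hb0 := Real.sqrt_pos.2 hb
  have hc0 := Real.sqrt_pos.2 hc
  generalize √(1 - ‖x.coords‖ ^ 2) = a at *
  generalize √(1 - ‖y.coords‖ ^ 2) = b at *
  generalize √(1 - ‖z.coords‖ ^ 2) = c at *
  generalize coshDist x y = A at *
  generalize coshDist y z = B at *
  generalize coshDist x z = C at *
  have hcs := form_cauchy_schwarz y
    ((1 - ⟪x.coords, y.coords⟫) • y.coords - (1 - ‖y.coords‖ ^ 2) • x.coords)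
    ((1 - ⟪y.coords, z.coords⟫) • y.coords - (1 - ‖y.coords‖ ^ 2) • z.coords)
  rw [norm_sub_sq_real, norm_sub_sq_real] at hcs
  simp only [inner_sub_left, inner_sub_right, real_inner_smul_left, real_inner_smul_right,
    norm_smul, mul_pow, Real.norm_eq_abs, sq_abs, real_inner_self_eq_norm_sq] at hcs
  rw [real_inner_comm x.coords y.coords, real_inner_comm y.coords z.coords] at hcs
  rw [show ⟪x.coords, y.coords⟫ = 1 - A * (a * b) by linarith,
    show ⟪y.coords, z.coords⟫ = 1 - B * (b * c) by linarith,
    show ⟪x.coords, z.coords⟫ = 1 - C * (a * c) by linarith,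
    show ‖x.coords‖ ^ 2 = 1 - a ^ 2 by linarith,
    show ‖y.coords‖ ^ 2 = 1 - b ^ 2 by linarith,
    show ‖z.coords‖ ^ 2 = 1 - c ^ 2 by linarith] at hcs
  have hk : 0 < (a * b ^ 4 * c) ^ 2 := by positivity
  have h1 : (a * b ^ 4 * c) ^ 2 * (A * B - C) ^ 2 ≤
      (a * b ^ 4 * c) ^ 2 * ((A ^ 2 - 1) * (B ^ 2 - 1)) := by
    ring_nf at hcs ⊢
    exact hcs
  have h2 := le_of_mul_le_mul_left h1 hk
  rw [← Real.sqrt_mul (by nlinarith)]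
  have h3 := Real.abs_le_sqrt h2
  have h4 := neg_abs_le (A * B - C)
  linarith

theorem dist_triangle_aux (x y z : HypSpace d) : dist x z ≤ dist x y + dist y z := by
  have hxy := one_le_coshDist x y
  have hyz := one_le_coshDist y z
  have hxz := one_le_coshDist x z
  have h := coshDist_triangle x y z
  rw [← Real.sinh_arcosh hxy, ← Real.sinh_arcosh hyz] at h
  have h' : Real.cosh (Real.arcosh (coshDist x z)) ≤
      Real.cosh (Real.arcosh (coshDist x y) + Real.arcosh (coshDist y z)) := by
    rw [Real.cosh_add, Real.cosh_arcosh hxz, Real.cosh_arcosh hxy, Real.cosh_arcosh hyz]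
    exact h
  rw [Real.cosh_le_cosh,
    abs_of_nonneg (Real.arcosh_nonneg hxz),
    abs_of_nonneg (add_nonneg (Real.arcosh_nonneg hxy) (Real.arcosh_nonneg hyz))] at h'
  exact h'

noncomputable instance : MetricSpace (HypSpace d) where
  dist_self x := by rw [dist_def, coshDist_self, Real.arcosh_zero]
  dist_comm x y := by rw [dist_def, dist_def, coshDist_comm]
  dist_triangle := dist_triangle_aux
  eq_of_dist_eq_zero {x y} h :=
    eq_of_coshDist_eq_one ((Real.arcosh_eq_zero_iff (one_le_coshDist x y)).1 h)

instance : MeasurableSpace (HypSpace d) :=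
  MeasurableSpace.comap coords inferInstance

/-- Hyperbolic volume: in the projective ball model the volume element at the point `x` is
`(1 - ‖x‖²) ^ (-(d + 1) / 2) dx`. -/
noncomputable instance : MeasureSpace (HypSpace d) where
  volume := Measure.comap coords
    ((volume : Measure (EuclideanSpace ℝ (Fin d))).withDensity
      fun x => ENNReal.ofReal ((1 - ‖x‖ ^ 2) ^ (-((d : ℝ) + 1) / 2)))

theorem volume_eq_lintegral (s : Set (HypSpace d)) (hs : MeasurableSet s) :
    volume s = ∫⁻ x in coords '' s, ENNReal.ofReal ((1 - ‖x‖ ^ 2) ^ (-((d : ℝ) + 1) / 2)) := by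
  have hinj : Function.Injective (coords (d := d)) := fun x y h => HypSpace.ext h
  have hrange : Set.range (coords (d := d)) = Metric.ball 0 1 := by
    ext v
    simp only [Set.mem_range, mem_ball_zero_iff]
    exact ⟨fun ⟨x, hx⟩ => hx ▸ x.norm_coords_lt_one, fun h => ⟨⟨v, h⟩, rfl⟩⟩
  have himg : ∀ t : Set (HypSpace d), MeasurableSet t → MeasurableSet (coords '' t) := by
    rintro t ⟨u, hu, rfl⟩
    rw [Set.image_preimage_eq_inter_range, hrange]
    exact hu.inter measurableSet_ball
  change Measure.comap coords _ s = _
  rw [Measure.comap_apply _ hinj himg _ hs, withDensity_apply _ (himg s hs)]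

end HypSpace

/-! ### Simplices containing a ball: radial measures on a Euclidean space -/

section Radial

open Set Metric

variable {E : Type*} [NormedAddCommGroup E] [InnerProductSpace ℝ E]

/-! Both geometries reduce to one Euclidean problem. Move the centre of the ball to the origin. In
the Beltrami–Klein model hyperbolic convex hulls are Euclidean ones, balls about the origin are
Euclidean balls of radius `tanh r`, and the volume density increases with the distance from the
origin. So it suffices to study simplices containing `closedBall 0 ρ` and a measure with
nondecreasing radial density (`radialMeasure`).

The main tool is Steiner symmetrization parallel to an edge. The midpoints of the chords of a
simplex parallel to an edge lie in a hyperplane, so the symmetral about the hyperplane through the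
origin orthogonal to the edge is again a simplex, the image under the affine involution `edgeSymm`.
It still contains the ball, its vertices obey the same norm bound, and its measure is not larger
(`radialMeasure_edgeSymm_le`). Hence the symmetral of a minimizer is a minimizer. Every facet of a
minimizer touches the ball, since otherwise a homothety would cut off a piece of positive measure
(`IsRadialMin.exists_mem_facet`). A touching point on a facet of the symmetral shows that the
original simplex was already symmetric in that hyperplane (`edgeOffset_eq_edgeHeight`). Symmetry for
all edges fixes the Gram matrix of the vertices (`inner_eq_of_balanced`), so minimizers are regular
and unique up to a linear isometry.

Minimizers with vertices of norm at most `R` exist by compactness and lower semicontinuity. Their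
Gram matrix does not depend on `R`, so they are minimal without the bound too; in the hyperbolic
case a bound `R < 1` keeps the vertices inside the model. Conversely, the vertices of a regular
circumscribed simplex are equidistant from the centre of the ball (`norm_eq_of_dist_eq_of_touch`,
`norm_eq_of_lorentz_eq_of_touch`), which gives the same Gram matrix, hence the same measure as a
minimizer. -/

/-- A hyperplane touching a ball centred at the origin. -/
theorem touch_of_nonneg_ball {ρ a : ℝ} (hρ : 0 < ρ) {β z : E}
    (h0 : ∀ x ∈ closedBall (0 : E) ρ, 0 ≤ a + ⟪β, x⟫) (hz : z ∈ closedBall (0 : E) ρ)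
    (hz0 : a + ⟪β, z⟫ = 0) : a = ρ * ‖β‖ ∧ ρ • β = -(‖β‖ • z) := by
  rw [mem_closedBall_zero_iff] at hz
  rcases eq_or_ne β 0 with rfl | hβ
  · simp_all
  have hβ' : 0 < ‖β‖ := norm_pos_iff.2 hβ
  -- The point of the ball where the affine function is smallest.
  have h1 := h0 (-(ρ / ‖β‖) • β) (by
    rw [mem_closedBall_zero_iff, norm_smul, norm_neg, norm_div, norm_norm, Real.norm_eq_abs,
      abs_of_pos hρ, div_mul_cancel₀ _ hβ'.ne'])
  rw [real_inner_smul_right, real_inner_self_eq_norm_sq] at h1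
  have h1' : ρ * ‖β‖ ≤ a := by
    have : -(ρ / ‖β‖) * ‖β‖ ^ 2 = -(ρ * ‖β‖) := by field_simp
    linarith
  have h2 := neg_le_of_abs_le (abs_real_inner_le_norm β z)
  have h3 : ‖β‖ * ‖z‖ ≤ ‖β‖ * ρ := by gcongr
  have ha : a = ρ * ‖β‖ := by linarith
  refine ⟨ha, ?_⟩
  have h4 : ⟪β, z⟫ = -(ρ * ‖β‖) := by linarith
  have h5 : ‖ρ • β + ‖β‖ • z‖ ^ 2 ≤ 0 := by
    rw [norm_add_sq_real, norm_smul, norm_smul, real_inner_smul_left, real_inner_smul_right, h4,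
      norm_norm, Real.norm_eq_abs, abs_of_pos hρ]
    have : ‖z‖ ^ 2 ≤ ρ ^ 2 := by gcongr
    nlinarith [mul_le_mul_of_nonneg_left this (sq_nonneg ‖β‖)]
  have h6 : ρ • β + ‖β‖ • z = 0 := by
    rw [← norm_eq_zero]; exact pow_eq_zero_iff two_ne_zero |>.1 (le_antisymm h5 (sq_nonneg _))
  exact eq_neg_of_add_eq_zero_left h6

variable {ι : Type*} [Fintype ι]

theorem isCompact_convexHull_range (p : ι → E) : IsCompact (convexHull ℝ (range p)) :=
  (finite_range p).isCompact_convexHull ℝ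

theorem AffineBasis.mem_convexHull_image_ne_iff (b : AffineBasis ι ℝ E) (i : ι) (x : E) :
    x ∈ convexHull ℝ (b '' {j | j ≠ i}) ↔ x ∈ convexHull ℝ (range b) ∧ b.coord i x = 0 := by
  constructor
  · intro hx
    refine ⟨convexHull_mono (image_subset_range _ _) hx, ?_⟩
    have hc : Convex ℝ {x | b.coord i x = 0} := by
      have := (convex_singleton (0 : ℝ)).affine_preimage (b.coord i)
      exact this
    refine convexHull_min ?_ hc hx
    rintro _ ⟨j, hj, rfl⟩
    exact b.coord_apply_ne (Ne.symm hj)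
  · classical
    rintro ⟨hx, h0⟩
    rw [b.convexHull_eq_nonneg_coord] at hx
    rw [← b.linear_combination_coord_eq_self x, ← Finset.sum_erase (a := i) _ (by simp [h0])]
    refine (convex_convexHull ℝ _).sum_mem (fun j _ => hx j) ?_ (fun j hj => ?_)
    · rw [← b.sum_coord_apply_eq_one x]
      exact Finset.sum_erase (f := fun k => b.coord k x) _ h0
    · exact subset_convexHull ℝ _ ⟨j, Finset.ne_of_mem_erase hj, rfl⟩

variable [FiniteDimensional ℝ E]

theorem exists_affineBasis_of_ball_subset (hcard : Fintype.card ι = Module.finrank ℝ E + 1)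
    {ρ : ℝ} (hρ : 0 < ρ) {p : ι → E} (hB : closedBall 0 ρ ⊆ convexHull ℝ (range p)) :
    ∃ b : AffineBasis ι ℝ E, ⇑b = p := by
  have hne : (interior (convexHull ℝ (range p))).Nonempty :=
    ⟨0, interior_mono hB (by rw [interior_closedBall _ hρ.ne']; simpa using hρ)⟩
  have htop := interior_convexHull_nonempty_iff_affineSpan_eq_top.1 hne
  refine ⟨⟨p, ?_, htop⟩, rfl⟩
  rw [affineIndependent_iff_finrank_vectorSpan_eq ℝ p hcard, ← direction_affineSpan, htop,
    AffineSubspace.direction_top, finrank_top]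

theorem AffineMap.exists_inner_add (f : E →ᵃ[ℝ] ℝ) : ∃ β : E, ∀ x, f x = f 0 + ⟪β, x⟫ := by
  refine ⟨(InnerProductSpace.toDual ℝ E).symm (LinearMap.toContinuousLinearMap f.linear),
    fun x => ?_⟩
  rw [InnerProductSpace.toDual_symm_apply]
  have := congrFun f.decomp x
  simp only [Pi.add_apply] at this
  rw [this, add_comm]
  simp

variable [MeasurableSpace E] [BorelSpace E]

/-- The measure with density `φ ‖x‖` at the point `x`. -/
noncomputable def radialMeasure (φ : ℝ → ℝ≥0∞) : Measure E :=
  volume.withDensity fun x => φ ‖x‖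

/-- Among the simplices with vertices in the ball of radius `R` which contain the ball of radius
`ρ` (both centred at the origin), the one with vertices `p` has minimal radial measure. -/
structure IsRadialMin (φ : ℝ → ℝ≥0∞) (R ρ : ℝ) (p : ι → E) : Prop where
  ball_subset : closedBall 0 ρ ⊆ convexHull ℝ (range p)
  norm_le : ∀ i, ‖p i‖ ≤ R
  measure_le : ∀ q : ι → E, closedBall 0 ρ ⊆ convexHull ℝ (range q) → (∀ i, ‖q i‖ ≤ R) →
    radialMeasure φ (convexHull ℝ (range p)) ≤ radialMeasure φ (convexHull ℝ (range q))

theorem radialMeasure_pos_of_isOpen {φ : ℝ → ℝ≥0∞} (hφ : Monotone φ) (h0 : φ 0 ≠ 0) {U : Set E}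
    (hU : IsOpen U) (hne : U.Nonempty) : 0 < radialMeasure φ U := by
  rw [radialMeasure, withDensity_apply _ hU.measurableSet,
    setLIntegral_pos_iff (f := fun x : E => φ ‖x‖) (hφ.measurable.comp measurable_norm)]
  have : Function.support (fun x : E => φ ‖x‖) = univ := by
    ext x
    simpa using ((pos_iff_ne_zero.2 h0).trans_le (hφ (norm_nonneg x))).ne'
  rw [this, univ_inter]
  exact hU.measure_pos _ hne

/-- If the ball missed the facet, the `i`-th barycentric coordinate would be at least some `ε > 0`
on it. The homothety with centre `b i` and ratio `1 - ε` maps the simplex onto its part where this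
coordinate is at least `ε`, which still contains the ball and respects the norm bound. Finiteness of
the measure makes the loss strict. -/
theorem IsRadialMin.exists_mem_facet [Nontrivial ι]
    (hcard : Fintype.card ι = Module.finrank ℝ E + 1)
    {φ : ℝ → ℝ≥0∞} (hφ : Monotone φ) (h0 : φ 0 ≠ 0) {R ρ : ℝ} (hρ : 0 < ρ) {p : ι → E}
    (hp : IsRadialMin φ R ρ p) (hfin : radialMeasure φ (convexHull ℝ (range p)) ≠ ∞) (i : ι) :
    ∃ z ∈ closedBall (0 : E) ρ, z ∈ convexHull ℝ (p '' {j | j ≠ i}) := by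
  obtain ⟨b, rfl⟩ := exists_affineBasis_of_ball_subset hcard hρ hp.ball_subset
  by_contra! hcon
  have hS := b.convexHull_eq_nonneg_coord
  have hpos : ∀ x ∈ closedBall (0 : E) ρ, 0 < b.coord i x := by
    intro x hx
    have h1 := hp.ball_subset hx
    refine lt_of_le_of_ne (by rw [hS] at h1; exact h1 i) fun h => hcon x hx ?_
    exact (b.mem_convexHull_image_ne_iff i x).2 ⟨h1, h.symm⟩
  have hcont : Continuous (b.coord i) := (b.coord i).continuous_of_finiteDimensional
  obtain ⟨z, hz, hzmin⟩ := (isCompact_closedBall (0 : E) ρ).exists_isMinOn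
    ⟨0, by simpa using hρ.le⟩ hcont.continuousOn
  obtain ⟨ε, hε0, hε1, hεz⟩ : ∃ ε : ℝ, 0 < ε ∧ ε < 1 ∧ ε ≤ b.coord i z :=
    ⟨min (b.coord i z) (1 / 2), lt_min (hpos z hz) (by norm_num),
      (min_le_right _ _).trans_lt (by norm_num), min_le_left _ _⟩
  have hε : ∀ x ∈ closedBall (0 : E) ρ, ε ≤ b.coord i x := fun x hx => hεz.trans (hzmin hx)
  set f : E →ᵃ[ℝ] E := AffineMap.homothety (b i) (1 - ε) with hf
  have hfapp : ∀ x, f x = AffineMap.lineMap (b i) x (1 - ε) := fun x => by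
    rw [hf, AffineMap.homothety_eq_lineMap]
  have hcoord : ∀ x k, b.coord k (f x) = ε * b.coord k (b i) + (1 - ε) * b.coord k x := by
    intro x k
    rw [hfapp, AffineMap.apply_lineMap, AffineMap.lineMap_apply]
    simp only [vsub_eq_sub, vadd_eq_add, smul_eq_mul]
    ring
  have himg : convexHull ℝ (range (f ∘ b)) = f '' convexHull ℝ (range b) := by
    rw [range_comp, AffineMap.image_convexHull]
  have hsub : convexHull ℝ (range (f ∘ b)) ⊆ convexHull ℝ (range b) := by
    refine convexHull_min ?_ (convex_convexHull _ _)
    rintro _ ⟨k, rfl⟩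
    rw [Function.comp, hfapp]
    exact (convex_convexHull ℝ (range b)).lineMap_mem (subset_convexHull _ _ ⟨i, rfl⟩)
      (subset_convexHull _ _ ⟨k, rfl⟩) ⟨by linarith, by linarith⟩
  have hball : closedBall (0 : E) ρ ⊆ convexHull ℝ (range (f ∘ b)) := by
    intro x hx
    have hxS := hp.ball_subset hx
    rw [hS] at hxS
    have h1ε : (1 - ε) ≠ 0 := by linarith
    have hfy : f (AffineMap.lineMap (b i) x (1 - ε)⁻¹) = x := by
      rw [hfapp]
      simp [AffineMap.lineMap_apply, h1ε]
    rw [himg]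
    refine ⟨_, ?_, hfy⟩
    rw [hS]
    intro k
    have h2 := hcoord (AffineMap.lineMap (b i) x (1 - ε)⁻¹) k
    rw [hfy] at h2
    have h3 : 0 ≤ (1 - ε) * b.coord k (AffineMap.lineMap (b i) x (1 - ε)⁻¹) := by
      rcases eq_or_ne k i with rfl | hk
      · rw [b.coord_apply_eq] at h2
        linarith [hε x hx]
      · rw [b.coord_apply_ne hk] at h2
        linarith [hxS k]
    exact nonneg_of_mul_nonneg_right h3 (by linarith)
  have hR : ∀ k, ‖(f ∘ b) k‖ ≤ R := by
    intro k
    rw [Function.comp, hfapp, ← mem_closedBall_zero_iff]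
    exact (convex_closedBall (0 : E) R).lineMap_mem (by simpa using hp.norm_le i)
      (by simpa using hp.norm_le k) ⟨by linarith, by linarith⟩
  have hle := hp.measure_le _ hball hR
  -- An open part of the removed slab; it is nonempty because it comes close to any vertex `b j`
  -- with `j ≠ i`.
  set U : Set E := interior (convexHull ℝ (range b)) ∩ {x | b.coord i x < ε} with hUdef
  have hUo : IsOpen U := isOpen_interior.inter (isOpen_lt hcont continuous_const)
  obtain ⟨j, hj⟩ := exists_ne i
  have hUne : U.Nonempty := by
    have hint : (interior (convexHull ℝ (range b))).Nonempty :=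
      ⟨0, interior_mono hp.ball_subset (by rw [interior_closedBall _ hρ.ne']; simpa using hρ)⟩
    have hmem : b j ∈ closure (interior (convexHull ℝ (range b))) := by
      rw [(convex_convexHull ℝ _).closure_interior_eq_closure_of_nonempty_interior hint]
      exact subset_closure (subset_convexHull _ _ ⟨j, rfl⟩)
    obtain ⟨x, hx1, hx2⟩ := mem_closure_iff.1 hmem {x | b.coord i x < ε}
      (isOpen_lt hcont continuous_const) (by simpa [b.coord_apply_ne hj.symm] using hε0)
    exact ⟨x, hx2, hx1⟩
  have hdisj : Disjoint (convexHull ℝ (range (f ∘ b))) U := by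
    rw [Set.disjoint_left]
    rintro x hx ⟨-, hx2⟩
    rw [himg] at hx
    obtain ⟨y, hy, rfl⟩ := hx
    rw [hS] at hy
    simp only [mem_ofPred_eq, hcoord, b.coord_apply_eq] at hx2
    nlinarith [hy i]
  have hsum : radialMeasure φ (convexHull ℝ (range (f ∘ b))) + radialMeasure φ U ≤
      radialMeasure φ (convexHull ℝ (range b)) := by
    rw [← measure_union hdisj hUo.measurableSet]
    exact measure_mono (union_subset hsub (inter_subset_left.trans interior_subset))
  have hlt : radialMeasure φ (convexHull ℝ (range (f ∘ b))) <
      radialMeasure φ (convexHull ℝ (range b)) :=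
    lt_of_lt_of_le (ENNReal.lt_add_right (ne_top_of_le_ne_top hfin (measure_mono hsub))
      (radialMeasure_pos_of_isOpen hφ h0 hUo hUne).ne') hsum
  exact absurd hle (not_le.2 hlt)

end Radial

/-! ### Steiner symmetrization of a simplex along an edge -/

section Symmetrization

open Set Metric

/-- The common part `S ∩ Θ ⁻¹' S` cancels, and `Θ` exchanges the two differences; on what remains,
passing from `x` to `Θ x` does not increase the weight. -/
theorem lintegral_le_of_involutive {α : Type*} [MeasurableSpace α] {μ : Measure α} {Θ : α → α}
    (hinv : Function.Involutive Θ) (hΘ : MeasurePreserving Θ μ μ) {w : α → ℝ≥0∞}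
    (hw : Measurable w) {S : Set α} (hS : MeasurableSet S)
    (hle : ∀ x ∈ S, Θ x ∉ S → w (Θ x) ≤ w x) :
    ∫⁻ x in Θ ⁻¹' S, w x ∂μ ≤ ∫⁻ x in S, w x ∂μ := by
  have hS' : MeasurableSet (Θ ⁻¹' S) := hΘ.measurable hS
  rw [← lintegral_inter_add_sdiff w (Θ ⁻¹' S) hS, ← lintegral_inter_add_sdiff w S hS',
    inter_comm]
  gcongr 1
  have hpre : Θ ⁻¹' (Θ ⁻¹' S \ S) = S \ Θ ⁻¹' S := by
    ext x
    simp [hinv x]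
  rw [← hΘ.setLIntegral_comp_preimage (hS'.diff hS) hw, hpre]
  exact setLIntegral_mono hw fun x hx => hle x hx.1 hx.2

theorem LinearMap.abs_det_of_involutive {V : Type*} [AddCommGroup V] [Module ℝ V]
    {f : V →ₗ[ℝ] V} (hf : Function.Involutive f) : |LinearMap.det f| = 1 := by
  have h : f ∘ₗ f = LinearMap.id := LinearMap.ext hf
  have h2 := congrArg LinearMap.det h
  rw [LinearMap.det_comp, LinearMap.det_id] at h2
  have := abs_mul_abs_self (LinearMap.det f)
  rw [h2] at this
  nlinarith [abs_nonneg (LinearMap.det f)]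

variable {E : Type*} [NormedAddCommGroup E] [InnerProductSpace ℝ E]

/-- The linear part is an involution as well, so its determinant is `±1`. -/
theorem measurePreserving_of_involutive [FiniteDimensional ℝ E] [MeasurableSpace E] [BorelSpace E]
    {Θ : E →ᵃ[ℝ] E}
    (hΘ : Function.Involutive Θ) : MeasurePreserving Θ (volume : Measure E) volume := by
  have hlin : ∀ x, Θ x = Θ.linear x + Θ 0 := fun x => by
    have := congrFun Θ.decomp x
    simpa using this
  have hinv : Function.Involutive Θ.linear := by
    intro x
    have h1 := hΘ x
    have h2 := hΘ 0
    rw [hlin (Θ x), hlin x, map_add] at h1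
    rw [hlin (Θ 0)] at h2
    have : Θ.linear (Θ.linear x) + (Θ.linear (Θ 0) + Θ 0) = x := by
      rw [← add_assoc, h1]
    rwa [h2, add_zero] at this
  have hdet := LinearMap.abs_det_of_involutive hinv
  have hne : LinearMap.det Θ.linear ≠ 0 := fun h => by simp [h] at hdet
  have h1 : MeasurePreserving Θ.linear (volume : Measure E) volume := by
    refine ⟨(LinearMap.continuous_of_finiteDimensional _).measurable, ?_⟩
    rw [Measure.map_linearMap_addHaar_eq_smul_addHaar _ hne, abs_inv, hdet]
    simp
  have h2 := (measurePreserving_add_right (volume : Measure E) (Θ 0)).comp h1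
  have h3 : (⇑Θ) = (fun x => x + Θ 0) ∘ Θ.linear := funext hlin
  rw [h3]
  exact h2

variable {ι : Type*}

namespace AffineBasis

variable (b : AffineBasis ι ℝ E) (i j : ι)

/-- The height of a point above the hyperplane through the origin orthogonal to the edge
`b i`, `b j`, in units of the length of the edge. -/
noncomputable def edgeHeight : E →ᵃ[ℝ] ℝ :=
  ((‖b j - b i‖ ^ 2)⁻¹ • (innerₗ E (b j - b i))).toAffineMap

/-- The signed distance from a point to the midpoint of the chord of the simplex through this
point parallel to the edge `b i`, `b j`, in units of the length of the edge. -/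
noncomputable def edgeOffset : E →ᵃ[ℝ] ℝ :=
  (2⁻¹ : ℝ) • (b.coord j - b.coord i)

/-- The affine involution which maps every chord of the simplex parallel to the edge `b i`, `b j`
to its translate centred at the hyperplane through the origin orthogonal to this edge, reversing
the direction. -/
noncomputable def edgeSymm : E →ᵃ[ℝ] E :=
  AffineMap.id ℝ E -
    (LinearMap.toSpanSingleton ℝ E (b j - b i)).toAffineMap.comp
      (b.edgeHeight i j + b.edgeOffset i j)

theorem edgeHeight_apply (x : E) :
    b.edgeHeight i j x = (‖b j - b i‖ ^ 2)⁻¹ * ⟪b j - b i, x⟫ := by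
  simp only [edgeHeight, LinearMap.coe_toAffineMap, LinearMap.smul_apply, innerₗ_apply_apply,
    smul_eq_mul]

theorem edgeOffset_apply (x : E) :
    b.edgeOffset i j x = 2⁻¹ * (b.coord j x - b.coord i x) := by
  simp [edgeOffset]

theorem edgeSymm_apply (x : E) : b.edgeSymm i j x =
    x - (b.edgeHeight i j x + b.edgeOffset i j x) • (b j - b i) := by
  simp [edgeSymm, add_smul]

variable {i j}

theorem coord_add_smul_sub (k : ι) (x : E) (s : ℝ) :
    b.coord k (x + s • (b j - b i)) = b.coord k x + s * (b.coord k (b j) - b.coord k (b i)) := by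
  have h := (b.coord k).map_vadd x (s • (b j - b i))
  have h2 := (b.coord k).linearMap_vsub (b j) (b i)
  rw [vadd_eq_add, vadd_eq_add, map_smul, ← vsub_eq_sub (b j), h2] at h
  rw [add_comm x, ← vsub_eq_sub (b j), h, vsub_eq_sub, smul_eq_mul, add_comm]

theorem coord_edge_left (hij : i ≠ j) (x : E) (s : ℝ) :
    b.coord i (x + s • (b j - b i)) = b.coord i x - s := by
  rw [coord_add_smul_sub, b.coord_apply_eq, b.coord_apply_ne hij]; ring

theorem coord_edge_right (hij : i ≠ j) (x : E) (s : ℝ) :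
    b.coord j (x + s • (b j - b i)) = b.coord j x + s := by
  rw [coord_add_smul_sub, b.coord_apply_eq, b.coord_apply_ne hij.symm]; ring

theorem coord_edge_of_ne {k : ι} (hi : k ≠ i) (hj : k ≠ j) (x : E) (s : ℝ) :
    b.coord k (x + s • (b j - b i)) = b.coord k x := by
  rw [coord_add_smul_sub, b.coord_apply_ne hi, b.coord_apply_ne hj]; ring

theorem norm_edge_pos (hij : i ≠ j) : 0 < ‖b j - b i‖ ^ 2 := by
  have := sub_ne_zero.2 fun h => hij (b.ind.injective h).symm
  positivity

theorem edgeHeight_add_smul (hij : i ≠ j) (x : E) (s : ℝ) :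
    b.edgeHeight i j (x + s • (b j - b i)) = b.edgeHeight i j x + s := by
  rw [edgeHeight_apply, edgeHeight_apply, inner_add_right, real_inner_smul_right,
    real_inner_self_eq_norm_sq, mul_add, mul_left_comm, inv_mul_cancel₀ (b.norm_edge_pos hij).ne',
    mul_one]

theorem edgeOffset_add_smul (hij : i ≠ j) (x : E) (s : ℝ) :
    b.edgeOffset i j (x + s • (b j - b i)) = b.edgeOffset i j x + s := by
  rw [edgeOffset_apply, edgeOffset_apply, b.coord_edge_left hij, b.coord_edge_right hij]
  ring

theorem edgeSymm_eq_add (x : E) : b.edgeSymm i j x =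
    x + (-(b.edgeHeight i j x + b.edgeOffset i j x)) • (b j - b i) := by
  rw [edgeSymm_apply, neg_smul, sub_eq_add_neg]

theorem edgeSymm_involutive (hij : i ≠ j) : Function.Involutive (b.edgeSymm i j) := by
  intro x
  rw [b.edgeSymm_eq_add (b.edgeSymm i j x), edgeSymm_eq_add, b.edgeHeight_add_smul hij,
    b.edgeOffset_add_smul hij, add_assoc, ← add_smul]
  simp

theorem norm_add_smul_edge_sq (hij : i ≠ j) (x : E) (s : ℝ) :
    ‖x + s • (b j - b i)‖ ^ 2 =
      ‖x‖ ^ 2 + ‖b j - b i‖ ^ 2 * ((b.edgeHeight i j x + s) ^ 2 - b.edgeHeight i j x ^ 2) := by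
  have h : ⟪b j - b i, x⟫ = ‖b j - b i‖ ^ 2 * b.edgeHeight i j x := by
    rw [edgeHeight_apply, mul_inv_cancel_left₀ (b.norm_edge_pos hij).ne']
  rw [norm_add_sq_real, real_inner_smul_right, real_inner_comm, h, norm_smul, Real.norm_eq_abs,
    mul_pow, sq_abs]
  ring

/-- Along a line parallel to the edge, `edgeSymm` turns height `h` and offset `o` into `-o` and
`-h`; only the height contributes to the change of norm. -/
theorem norm_edgeSymm_sq (hij : i ≠ j) (x : E) : ‖b.edgeSymm i j x‖ ^ 2 =
    ‖x‖ ^ 2 + ‖b j - b i‖ ^ 2 * (b.edgeOffset i j x ^ 2 - b.edgeHeight i j x ^ 2) := by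
  rw [edgeSymm_eq_add, b.norm_add_smul_edge_sq hij]
  ring

theorem norm_edgeSymm_le (hij : i ≠ j) {x : E}
    (h : |b.edgeOffset i j x| ≤ |b.edgeHeight i j x|) : ‖b.edgeSymm i j x‖ ≤ ‖x‖ := by
  have h1 := b.norm_edgeSymm_sq hij x
  have h2 := sq_le_sq.2 h
  refine le_of_sq_le_sq ?_ (norm_nonneg x)
  nlinarith [b.norm_edge_pos hij]

theorem coord_edgeSymm_left (hij : i ≠ j) (x : E) : b.coord i (b.edgeSymm i j x) =
    2⁻¹ * (b.coord i x + b.coord j x) + b.edgeHeight i j x := by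
  rw [edgeSymm_eq_add, b.coord_edge_left hij, edgeOffset_apply]; ring

theorem coord_edgeSymm_right (hij : i ≠ j) (x : E) : b.coord j (b.edgeSymm i j x) =
    2⁻¹ * (b.coord i x + b.coord j x) - b.edgeHeight i j x := by
  rw [edgeSymm_eq_add, b.coord_edge_right hij, edgeOffset_apply]; ring

theorem coord_edgeSymm_of_ne {k : ι} (hi : k ≠ i) (hj : k ≠ j) (x : E) :
    b.coord k (b.edgeSymm i j x) = b.coord k x := by
  rw [edgeSymm_eq_add, b.coord_edge_of_ne hi hj]

/-- The reflection in the hyperplane through the origin orthogonal to an edge. -/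
theorem norm_edge_reflection (hij : i ≠ j) (x : E) :
    ‖x + (-(2 * b.edgeHeight i j x)) • (b j - b i)‖ = ‖x‖ := by
  have h := b.norm_add_smul_edge_sq hij x (-(2 * b.edgeHeight i j x))
  rw [← sq_eq_sq₀ (norm_nonneg _) (norm_nonneg _), h]
  ring

theorem convexHull_range_edgeSymm (hij : i ≠ j) :
    convexHull ℝ (range (b.edgeSymm i j ∘ b)) = b.edgeSymm i j ⁻¹' convexHull ℝ (range b) := by
  rw [range_comp, ← AffineMap.image_convexHull]
  exact (b.edgeSymm_involutive hij).image_eq_preimage_symm ▸ rfl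

/-- The ball contains `x` and its mirror image, so the chord of the simplex through `x` contains
both points. Its half-length is therefore at least the distance from `x` to the mirror, and the
recentred chord still contains `x`. -/
theorem ball_subset_convexHull_edgeSymm (hij : i ≠ j) {ρ : ℝ}
    (hB : closedBall 0 ρ ⊆ convexHull ℝ (range b)) :
    closedBall 0 ρ ⊆ convexHull ℝ (range (b.edgeSymm i j ∘ b)) := by
  intro x hx
  have h1 := hB hx
  have h2 := hB (show x + (-(2 * b.edgeHeight i j x)) • (b j - b i) ∈ closedBall 0 ρ by
    rwa [mem_closedBall_zero_iff, b.norm_edge_reflection hij, ← mem_closedBall_zero_iff])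
  rw [b.convexHull_range_edgeSymm hij, mem_preimage]
  rw [b.convexHull_eq_nonneg_coord] at h1 h2 ⊢
  intro k
  rcases eq_or_ne k i with rfl | hi
  · have := h2 j
    rw [b.coord_edge_right hij] at this
    rw [b.coord_edgeSymm_left hij]
    have := h2 k
    rw [b.coord_edge_left hij] at this
    linarith [h1 k, h1 j]
  · rcases eq_or_ne k j with rfl | hj
    · have := h2 k
      rw [b.coord_edge_right hij] at this
      rw [b.coord_edgeSymm_right hij]
      linarith [h1 k, h1 i]
    · rw [b.coord_edgeSymm_of_ne hi hj]
      exact h1 k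

/-- The images of `b i` and `b j` have equal norm and heights `±1/2`. As the heights of `b i` and `b
j` differ by `1`, one of them is at least `1/2` in absolute value, and that vertex does not move
outwards. Every other vertex is projected orthogonally onto the mirror. -/
theorem norm_edgeSymm_vertex_le (hij : i ≠ j) {R : ℝ} (hR : ∀ k, ‖b k‖ ≤ R) (k : ι) :
    ‖b.edgeSymm i j (b k)‖ ≤ R := by
  have hoff : b.edgeOffset i j (b i) = -2⁻¹ := by
    rw [edgeOffset_apply, b.coord_apply_eq, b.coord_apply_ne hij.symm]; ring
  have hoff' : b.edgeOffset i j (b j) = 2⁻¹ := by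
    rw [edgeOffset_apply, b.coord_apply_eq, b.coord_apply_ne hij]; ring
  have hh : b.edgeHeight i j (b j) = b.edgeHeight i j (b i) + 1 := by
    rw [← b.edgeHeight_add_smul hij, one_smul, add_sub_cancel]
  have hsymm : ‖b.edgeSymm i j (b i)‖ = ‖b.edgeSymm i j (b j)‖ := by
    have h1 := b.norm_edgeSymm_sq hij (b i)
    have h2 := b.norm_edgeSymm_sq hij (b j)
    have h3 := b.norm_add_smul_edge_sq hij (b i) 1
    rw [one_smul, add_sub_cancel] at h3
    rw [← sq_eq_sq₀ (norm_nonneg _) (norm_nonneg _), h1, h2, h3, hoff, hoff', hh]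
    ring
  have hmain : ‖b.edgeSymm i j (b i)‖ ≤ R := by
    rcases le_or_gt 2⁻¹ |b.edgeHeight i j (b i)| with h | h
    · exact (b.norm_edgeSymm_le hij (by rw [hoff, abs_neg]; norm_num at h ⊢; exact h)).trans (hR i)
    · rw [hsymm]
      refine (b.norm_edgeSymm_le hij ?_).trans (hR j)
      rw [hoff', hh]
      have := abs_lt.1 h
      rw [abs_of_pos (by norm_num), abs_of_pos (by linarith)]
      linarith
  rcases eq_or_ne k i with rfl | hi
  · exact hmain
  · rcases eq_or_ne k j with rfl | hj
    · rwa [← hsymm]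
    · refine (b.norm_edgeSymm_le hij ?_).trans (hR k)
      rw [edgeOffset_apply, b.coord_apply_ne hi.symm, b.coord_apply_ne hj.symm]
      simp

/-- The image of `x` lies on the same chord line, at distance `|height|` from the midpoint of the
chord in edge units, whereas `x` is at distance `|offset|`. So if `x` leaves the simplex then
`|offset| ≤ |height|`, and its norm does not grow. -/
theorem radialMeasure_edgeSymm_le [Fintype ι] [FiniteDimensional ℝ E] [MeasurableSpace E]
    [BorelSpace E] (hij : i ≠ j) {φ : ℝ → ℝ≥0∞} (hφ : Monotone φ) :
    radialMeasure φ (convexHull ℝ (range (b.edgeSymm i j ∘ b))) ≤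
      radialMeasure φ (convexHull ℝ (range b)) := by
  have hm := (isCompact_convexHull_range b).measurableSet
  rw [radialMeasure, withDensity_apply _ (isCompact_convexHull_range _).measurableSet,
    withDensity_apply _ hm, b.convexHull_range_edgeSymm hij]
  refine lintegral_le_of_involutive (b.edgeSymm_involutive hij)
    (measurePreserving_of_involutive (b.edgeSymm_involutive hij))
    (hφ.measurable.comp measurable_norm) hm fun x hx hx' => ?_
  refine hφ (b.norm_edgeSymm_le hij ?_)
  rw [b.convexHull_eq_nonneg_coord] at hx hx'
  have h1 := hx i
  have h2 := hx j
  by_contra! hcon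
  rw [edgeOffset_apply] at hcon
  refine hx' fun k => ?_
  have h3 : |2⁻¹ * (b.coord j x - b.coord i x)| ≤ 2⁻¹ * (b.coord i x + b.coord j x) :=
    abs_le.2 ⟨by linarith, by linarith⟩
  have h4 := abs_le.1 (hcon.le.trans h3)
  rcases eq_or_ne k i with rfl | hi
  · rw [b.coord_edgeSymm_left hij]; linarith
  · rcases eq_or_ne k j with rfl | hj
    · rw [b.coord_edgeSymm_right hij]; linarith
    · rw [b.coord_edgeSymm_of_ne hi hj]; exact hx k

end AffineBasis

end Symmetrization

/-! ### Symmetry of minimizers and their Gram matrix -/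

section Balanced

open Set Metric Module

variable {E : Type*} [NormedAddCommGroup E] [InnerProductSpace ℝ E] {ι : Type*}

/-- The conclusion says that the simplex is symmetric in the mirror. The hypothesis on `z` puts `z`
on facet `j` and its mirror image on facet `i`. Both facets touch the ball there, so each normal is
determined by its touching point and the facets are mirror images. -/
theorem AffineBasis.edgeOffset_eq_edgeHeight (b : AffineBasis ι ℝ E) [FiniteDimensional ℝ E]
    {i j : ι} (hij : i ≠ j) {ρ : ℝ} (hρ : 0 < ρ) (hB : closedBall 0 ρ ⊆ convexHull ℝ (range b))
    {z : E} (hz : z ∈ closedBall (0 : E) ρ) (hz0 : b.coord i (b.edgeSymm i j z) = 0) (x : E) :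
    b.edgeOffset i j x = b.edgeHeight i j x := by
  have hz' : z + (-(2 * b.edgeHeight i j z)) • (b j - b i) ∈ closedBall (0 : E) ρ := by
    rwa [mem_closedBall_zero_iff, b.norm_edge_reflection hij, ← mem_closedBall_zero_iff]
  have hpos : ∀ k, ∀ y ∈ closedBall (0 : E) ρ, 0 ≤ b.coord k y := fun k y hy => by
    have := hB hy
    rw [b.convexHull_eq_nonneg_coord] at this
    exact this k
  rw [b.coord_edgeSymm_left hij] at hz0
  have h1 := hpos i z hz
  have h2 := hpos j z hz
  have h3 := hpos i _ hz'
  -- By `hz0`, two nonnegative numbers have sum zero: `coord i` at the mirror image of `z` and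
  -- `coord j` at `z`.
  have hzi : b.coord i (z + (-(2 * b.edgeHeight i j z)) • (b j - b i)) = 0 := by
    rw [b.coord_edge_left hij] at h3 ⊢
    linarith
  have hzj : b.coord j z = 0 := by
    rw [b.coord_edge_left hij] at h3
    linarith
  obtain ⟨u, hu⟩ := (b.coord i).exists_inner_add
  obtain ⟨v, hv⟩ := (b.coord j).exists_inner_add
  obtain ⟨hu0, hu1⟩ := touch_of_nonneg_ball hρ (fun y hy => hu y ▸ hpos i y hy) hz'
    (hu _ ▸ hzi)
  obtain ⟨hv0, hv1⟩ := touch_of_nonneg_ball hρ (fun y hy => hv y ▸ hpos j y hy) hz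
    (hv _ ▸ hzj)
  set D := b j - b i with hD
  have hDpos : 0 < ‖D‖ ^ 2 := b.norm_edge_pos hij
  have huD : ⟪u, D⟫ = -1 := by
    have h := b.coord_edge_left hij 0 1
    rw [one_smul, zero_add, hu] at h
    linarith
  have hvD : ⟪v, D⟫ = 1 := by
    have h := b.coord_edge_right hij 0 1
    rw [one_smul, zero_add, hv] at h
    linarith
  have hh : ∀ y, ⟪y, D⟫ = ‖D‖ ^ 2 * b.edgeHeight i j y := fun y => by
    rw [b.edgeHeight_apply, ← hD, real_inner_comm, mul_inv_cancel_left₀ hDpos.ne']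
  set t := b.edgeHeight i j z with ht
  -- Since `z` and its mirror image have opposite heights, the normalizations `⟪u, D⟫ = -1` and `⟪v,
  -- D⟫ = 1` force `‖u‖ = ‖v‖`. Then `v - u` is parallel to `D`.
  have e1 : ρ * ⟪u, D⟫ = -(‖u‖ * (-(t * ‖D‖ ^ 2))) := by
    rw [← real_inner_smul_left, hu1, inner_neg_left, real_inner_smul_left, inner_add_left,
      real_inner_smul_left, hh z, real_inner_self_eq_norm_sq]
    ring
  have e2 : ρ * ⟪v, D⟫ = -(‖v‖ * (t * ‖D‖ ^ 2)) := by
    rw [← real_inner_smul_left, hv1, inner_neg_left, real_inner_smul_left, hh z]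
    ring
  rw [huD] at e1
  rw [hvD] at e2
  have hne : t * ‖D‖ ^ 2 ≠ 0 := fun h => by rw [h] at e2; linarith
  have huv : ‖u‖ = ‖v‖ := by
    have : ‖u‖ * (t * ‖D‖ ^ 2) = ‖v‖ * (t * ‖D‖ ^ 2) := by linarith
    exact mul_right_cancel₀ hne this
  have hdiff : ρ • (v - u) = (-(2 * ‖v‖ * t)) • D := by
    rw [smul_sub, hu1, hv1, huv, smul_add, smul_smul]
    module
  have hdiff' : ∀ y, ρ * ⟪v - u, y⟫ = ρ * (2 * b.edgeHeight i j y) := fun y => by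
    rw [← real_inner_smul_left, hdiff, real_inner_smul_left, real_inner_comm, hh]
    linear_combination (-2 * b.edgeHeight i j y) * e2
  have hfin := mul_left_cancel₀ hρ.ne' (hdiff' x)
  rw [inner_sub_left] at hfin
  rw [b.edgeOffset_apply, hu x, hv x, hu0, hv0, huv]
  linarith

/-- The sum of the vertices has the same inner product with each vertex, hence with every point,
including `0`; so it vanishes. This gives the off-diagonal entries `-‖b i‖ ^ 2 / d`. The facets are
then at distance `‖b i‖ / d` from the origin, and touching makes this distance `ρ`. -/
theorem AffineBasis.inner_eq_of_balanced [Fintype ι] [DecidableEq ι]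
    (b : AffineBasis ι ℝ E) {d : ℕ} (hd : 1 ≤ d) (hcard : Fintype.card ι = d + 1)
    {ρ : ℝ} (hρ : 0 < ρ)
    (hB : closedBall 0 ρ ⊆ convexHull ℝ (range b))
    (hnorm : ∀ i j, ‖b i‖ = ‖b j‖) (hinner : ∀ i j k, k ≠ i → k ≠ j → ⟪b k, b i⟫ = ⟪b k, b j⟫)
    (htouch : ∃ i, ∃ z ∈ closedBall (0 : E) ρ, b.coord i z = 0) (i j : ι) :
    ⟪b i, b j⟫ = if i = j then (d * ρ) ^ 2 else -(d * ρ ^ 2) := by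
  have hd0 : (0 : ℝ) < d := by exact_mod_cast hd
  have hsum : ∀ i j, ⟪∑ k, b k, b i⟫ = ⟪∑ k, b k, b j⟫ := by
    intro i j
    rcases eq_or_ne i j with rfl | hij
    · rfl
    rw [sum_inner, sum_inner, ← sub_eq_zero, ← Finset.sum_sub_distrib,
      ← Finset.sum_subset (Finset.subset_univ {i, j}), Finset.sum_pair hij,
      real_inner_self_eq_norm_sq, real_inner_self_eq_norm_sq, hnorm i j, real_inner_comm]
    · ring
    · intro k _ hk
      simp only [Finset.mem_insert, Finset.mem_singleton, not_or] at hk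
      rw [hinner i j k hk.1 hk.2, sub_self]
  obtain ⟨i₀, z, hz, hz0⟩ := htouch
  have hconst : ∀ x, ⟪∑ k, b k, x⟫ = ⟪∑ k, b k, b i₀⟫ := fun x => by
    conv_lhs => rw [← b.linear_combination_coord_eq_self x, inner_sum]
    simp only [real_inner_smul_right, hsum _ i₀]
    rw [← Finset.sum_mul, b.sum_coord_apply_eq_one, one_mul]
  have hzero : ∀ x, ⟪∑ k, b k, x⟫ = 0 := fun x => by rw [hconst, ← hconst 0, inner_zero_right]
  have hoff : ∀ i j, i ≠ j → ⟪b i, b j⟫ = -(‖b i‖ ^ 2 / d) := by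
    intro i j hij
    have h := hzero (b i)
    rw [sum_inner, ← Finset.add_sum_erase _ _ (Finset.mem_univ i), real_inner_self_eq_norm_sq,
      Finset.sum_congr rfl (g := fun _ => ⟪b i, b j⟫), Finset.sum_const, nsmul_eq_mul,
      Finset.card_erase_of_mem (Finset.mem_univ i), Finset.card_univ, hcard,
      Nat.add_sub_cancel] at h
    · field_simp
      linarith
    · intro k hk
      rw [real_inner_comm]
      exact hinner k j i (Finset.ne_of_mem_erase hk).symm hij
  have hcoord : ∀ x, (1 + d) * b.coord i₀ x * ‖b i₀‖ ^ 2 = ‖b i₀‖ ^ 2 + d * ⟪b i₀, x⟫ := by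
    intro x
    have h1 : ⟪b i₀, x⟫ = b.coord i₀ x * ‖b i₀‖ ^ 2 -
        (1 - b.coord i₀ x) * (‖b i₀‖ ^ 2 / d) := by
      conv_lhs => rw [← b.linear_combination_coord_eq_self x, inner_sum]
      rw [← Finset.add_sum_erase _ _ (Finset.mem_univ i₀), real_inner_smul_right,
        real_inner_self_eq_norm_sq,
        Finset.sum_congr rfl (g := fun k => b.coord k x * (-(‖b i₀‖ ^ 2 / d))),
        ← Finset.sum_mul, ← b.sum_coord_apply_eq_one x,
        ← Finset.add_sum_erase _ (fun k => b.coord k x) (Finset.mem_univ i₀)]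
      · ring
      · intro k hk
        rw [real_inner_smul_right, hoff _ _ (Finset.ne_of_mem_erase hk).symm]
    rw [h1]
    field_simp
    ring
  obtain ⟨k₀, hk₀⟩ : ∃ k, k ≠ i₀ := by
    by_contra! h
    have : Subsingleton ι := ⟨fun a c => (h a).trans (h c).symm⟩
    have := Fintype.card_le_one_iff_subsingleton.2 this
    omega
  have hpos : 0 < ‖b i₀‖ := by
    rw [norm_pos_iff]
    intro h
    have : b k₀ = 0 := by rw [← norm_eq_zero, hnorm k₀ i₀, h, norm_zero]
    exact hk₀ (b.ind.injective (this.trans h.symm))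
  have hcoord' : ∀ x, (1 + d) * b.coord i₀ x = 1 + ⟪(d / ‖b i₀‖ ^ 2) • b i₀, x⟫ := fun x => by
    rw [real_inner_smul_left]
    field_simp
    linear_combination hcoord x
  obtain ⟨ht, -⟩ := touch_of_nonneg_ball hρ (a := 1) (β := (d / ‖b i₀‖ ^ 2) • b i₀) (z := z)
    (fun x hx => by
      rw [← hcoord']
      have := hB hx
      rw [b.convexHull_eq_nonneg_coord] at this
      exact mul_nonneg (by positivity) (this i₀)) hz (by rw [← hcoord', hz0, mul_zero])
  have hR : ‖b i₀‖ = d * ρ := by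
    rw [norm_smul, Real.norm_eq_abs, abs_of_pos (by positivity)] at ht
    field_simp at ht
    linarith
  split_ifs with hij
  · rw [hij, real_inner_self_eq_norm_sq, hnorm j i₀, hR]
  · rw [hoff i j hij, hnorm i i₀, hR]
    field_simp

variable [FiniteDimensional ℝ E] [Fintype ι]

/-- Equal Gram matrices give equal norms to all linear combinations with the same weights, in
particular to barycentric ones. -/
theorem exists_linearIsometryEquiv_of_inner_eq (hcard : Fintype.card ι = finrank ℝ E + 1)
    {ρ : ℝ} (hρ : 0 < ρ) {p q : ι → E} (hp : closedBall 0 ρ ⊆ convexHull ℝ (range p))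
    (h : ∀ i j, ⟪p i, p j⟫ = ⟪q i, q j⟫) :
    ∃ L : E ≃ₗᵢ[ℝ] E, ∀ i, L (p i) = q i := by
  obtain ⟨b, rfl⟩ := exists_affineBasis_of_ball_subset hcard hρ hp
  have hnorm : ∀ w : ι → ℝ, ‖∑ i, w i • b i‖ = ‖∑ i, w i • q i‖ := by
    intro w
    rw [← sq_eq_sq₀ (norm_nonneg _) (norm_nonneg _), ← real_inner_self_eq_norm_sq,
      ← real_inner_self_eq_norm_sq]
    simp only [sum_inner, inner_sum, real_inner_smul_left, real_inner_smul_right, h]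
  -- The barycentric extension is a priori only affine; fixing the origin makes it linear.
  have hzero : ∑ i, b.coord i 0 • q i = 0 := by
    rw [← norm_eq_zero, ← hnorm, b.linear_combination_coord_eq_self, norm_zero]
  set f : E →ₗ[ℝ] E := ∑ i, (b.coord i).linear.smulRight (q i) with hf
  have hfx : ∀ x, f x = ∑ i, b.coord i x • q i := by
    intro x
    have : ∀ i, b.coord i x = (b.coord i).linear x + b.coord i 0 := fun i => by
      simpa using congrFun (b.coord i).decomp x
    simp only [this, add_smul, Finset.sum_add_distrib, hzero, add_zero, hf, LinearMap.sum_apply,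
      LinearMap.smulRight_apply]
  let L : E →ₗᵢ[ℝ] E := ⟨f, fun x => by
    rw [hfx, ← hnorm, b.linear_combination_coord_eq_self]⟩
  refine ⟨L.toLinearIsometryEquiv rfl, fun i => ?_⟩
  classical
  change f (b i) = q i
  rw [hfx]
  simp [b.coord_apply]

variable [MeasurableSpace E] [BorelSpace E]

theorem LinearIsometryEquiv.radialMeasure_convexHull (L : E ≃ₗᵢ[ℝ] E) {φ : ℝ → ℝ≥0∞}
    (hφ : Monotone φ) (p : ι → E) :
    radialMeasure φ (convexHull ℝ (range (L ∘ p))) = radialMeasure φ (convexHull ℝ (range p)) := by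
  have hpre : L ⁻¹' (convexHull ℝ (range (L ∘ p))) = convexHull ℝ (range p) := by
    rw [range_comp]
    have := L.toLinearEquiv.toLinearMap.image_convexHull (range p)
    change L '' _ = convexHull ℝ (L '' _) at this
    rw [← this, preimage_image_eq _ L.injective]
  have hm : Measurable fun x : E => φ ‖x‖ := hφ.measurable.comp measurable_norm
  rw [radialMeasure, withDensity_apply _ (isCompact_convexHull_range _).measurableSet,
    withDensity_apply _ (isCompact_convexHull_range _).measurableSet,
    ← L.measurePreserving.setLIntegral_comp_preimage
      (isCompact_convexHull_range _).measurableSet hm, hpre]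
  simp

theorem IsRadialMin.inner_eq [DecidableEq ι] {d : ℕ} (hd : 1 ≤ d) (hdim : finrank ℝ E = d)
    (hcard : Fintype.card ι = d + 1)
    {φ : ℝ → ℝ≥0∞} (hφ : Monotone φ) (h0 : φ 0 ≠ 0) {R ρ : ℝ} (hρ : 0 < ρ) {p : ι → E}
    (hp : IsRadialMin φ R ρ p) (hfin : radialMeasure φ (convexHull ℝ (range p)) ≠ ∞) (i j : ι) :
    ⟪p i, p j⟫ = if i = j then (d * ρ) ^ 2 else -(d * ρ ^ 2) := by
  have hcard' : Fintype.card ι = finrank ℝ E + 1 := by rw [hdim, hcard]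
  have : Nontrivial ι := Fintype.one_lt_card_iff_nontrivial.1 (by omega)
  have hfacet := hp.exists_mem_facet hcard' hφ h0 hρ hfin
  obtain ⟨b, rfl⟩ := exists_affineBasis_of_ball_subset hcard' hρ hp.ball_subset
  have key : ∀ i j, i ≠ j → ∀ x, b.edgeOffset i j x = b.edgeHeight i j x := by
    intro i j hij x
    have hle := b.radialMeasure_edgeSymm_le hij hφ
    have hmin : IsRadialMin φ R ρ (b.edgeSymm i j ∘ b) :=
      ⟨b.ball_subset_convexHull_edgeSymm hij hp.ball_subset,
        b.norm_edgeSymm_vertex_le hij hp.norm_le,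
        fun q hq hqR => hle.trans (hp.measure_le q hq hqR)⟩
    obtain ⟨z, hz, hz'⟩ := hmin.exists_mem_facet hcard' hφ h0 hρ (ne_top_of_le_ne_top hfin hle) i
    refine b.edgeOffset_eq_edgeHeight hij hρ hp.ball_subset hz ?_ x
    rw [image_comp, ← AffineMap.image_convexHull] at hz'
    obtain ⟨y, hy, rfl⟩ := hz'
    rw [b.edgeSymm_involutive hij]
    exact ((b.mem_convexHull_image_ne_iff i y).1 hy).2
  refine b.inner_eq_of_balanced hd hcard hρ hp.ball_subset (fun i j => ?_)
    (fun i j k hki hkj => ?_) ?_ i j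
  · rcases eq_or_ne i j with rfl | hij
    · rfl
    have h1 := key i j hij (b i)
    rw [b.edgeOffset_apply, b.coord_apply_eq, b.coord_apply_ne hij.symm] at h1
    have h2 := b.norm_add_smul_edge_sq hij (b i) 1
    rw [one_smul, add_sub_cancel, ← h1] at h2
    rw [← sq_eq_sq₀ (norm_nonneg _) (norm_nonneg _), h2]
    ring
  · rcases eq_or_ne i j with rfl | hij
    · rfl
    have h1 := key i j hij (b k)
    rw [b.edgeOffset_apply, b.coord_apply_ne hki.symm, b.coord_apply_ne hkj.symm,
      b.edgeHeight_apply, sub_zero, mul_zero, eq_comm, mul_eq_zero, inner_sub_left] at h1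
    have h2 := h1.resolve_left (inv_ne_zero (b.norm_edge_pos hij).ne')
    rw [real_inner_comm, real_inner_comm (b j)]
    linarith
  · obtain ⟨z, hz, hz'⟩ := hfacet i
    exact ⟨i, z, hz, ((b.mem_convexHull_image_ne_iff i z).1 hz').2⟩

end Balanced

/-! ### Compactness and lower semicontinuity -/

section Existence

open Set Metric Module Filter Topology Pointwise

variable {E : Type*} [NormedAddCommGroup E] [InnerProductSpace ℝ E]

section Vertices

variable {ι : Type*} [Fintype ι]

/-- A point at positive distance `δ` from the hull of `p` stays outside when the vertices move by
less than `δ`, because the `δ`-thickening of a convex set is convex. -/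
theorem isClosed_setOf_subset_convexHull_range [Nonempty ι] (B : Set E) :
    IsClosed {p : ι → E | B ⊆ convexHull ℝ (range p)} := by
  have h : {p : ι → E | B ⊆ convexHull ℝ (range p)} =
      ⋂ x ∈ B, {p | x ∈ convexHull ℝ (range p)} := by
    ext p; simp [subset_def]
  rw [h]
  refine isClosed_biInter fun x _ => ?_
  rw [← isOpen_compl_iff, Metric.isOpen_iff]
  intro p hp
  have hcl : IsClosed (convexHull ℝ (range p)) := (isCompact_convexHull_range p).isClosed
  have hne : (convexHull ℝ (range p)).Nonempty := (range_nonempty p).convexHull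
  have hpos : 0 < infDist x (convexHull ℝ (range p)) :=
    (hcl.notMem_iff_infDist_pos hne).1 hp
  refine ⟨_, hpos, fun q hq hx => ?_⟩
  have hsub : convexHull ℝ (range q) ⊆
      thickening (infDist x (convexHull ℝ (range p))) (convexHull ℝ (range p)) := by
    refine convexHull_min ?_ ((convex_convexHull ℝ _).thickening _)
    rintro _ ⟨i, rfl⟩
    exact mem_thickening_iff.2 ⟨p i, subset_convexHull ℝ _ ⟨i, rfl⟩,
      (dist_le_pi_dist q p i).trans_lt hq⟩
  exact absurd ((mem_thickening_iff_infDist_lt hne).1 (hsub hx)) (lt_irrefl _)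

/-- Each `p i - q i` lies in `ε` times the ball, hence in `ε` times the hull of `q`; by convexity
the hull of `q` plus its `ε`-multiple is its `(1 + ε)`-multiple. -/
theorem smul_convexHull_subset_of_dist_lt {ρ ε : ℝ} (hε : 0 < ε)
    {p q : ι → E} (hq : closedBall 0 ρ ⊆ convexHull ℝ (range q)) (hpq : dist q p < ε * ρ) :
    (1 + ε)⁻¹ • convexHull ℝ (range p) ⊆ convexHull ℝ (range q) := by
  have hconv := convex_convexHull ℝ (range q)
  rw [← subset_smul_set_iff₀ (by positivity : (1 + ε) ≠ 0)]
  refine convexHull_min ?_ (hconv.smul _)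
  rintro _ ⟨i, rfl⟩
  rw [hconv.add_smul zero_le_one hε.le, one_smul]
  refine ⟨q i, subset_convexHull ℝ _ ⟨i, rfl⟩, p i - q i, ⟨ε⁻¹ • (p i - q i), hq ?_, ?_⟩,
    add_sub_cancel _ _⟩
  · rw [mem_closedBall_zero_iff, norm_smul, norm_inv, Real.norm_eq_abs, abs_of_pos hε,
      inv_mul_le_iff₀ hε, ← dist_eq_norm, dist_comm]
    exact (dist_le_pi_dist q p i).trans hpq.le
  · exact smul_inv_smul₀ hε.ne' _

end Vertices

variable [FiniteDimensional ℝ E] [MeasurableSpace E] [BorelSpace E]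

theorem radialMeasure_interior {φ : ℝ → ℝ≥0∞} {S : Set E} (hS : Convex ℝ S) :
    radialMeasure φ (interior S) = radialMeasure φ S := by
  refine measure_congr ?_
  refine (withDensity_absolutelyContinuous _ _).ae_eq ?_
  exact interior_ae_eq_of_null_frontier (hS.addHaar_frontier _)

variable {ι : Type*} [Fintype ι]

/-- Slightly shrunken copies of the simplex exhaust its interior, which carries the full measure,
and each copy is contained in all sufficiently close simplices that contain the ball. -/
theorem lowerSemicontinuousOn_radialMeasure_convexHull {φ : ℝ → ℝ≥0∞} {ρ : ℝ} (hρ : 0 < ρ) :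
    LowerSemicontinuousOn (fun p : ι → E => radialMeasure φ (convexHull ℝ (range p)))
      {p | closedBall 0 ρ ⊆ convexHull ℝ (range p)} := by
  intro p hp y hy
  set S := convexHull ℝ (range p) with hS
  have hconv : Convex ℝ S := convex_convexHull ℝ _
  have h0 : (0 : E) ∈ S := hp (by simpa using hρ.le)
  set t : ℕ → Set E := fun n => (1 + ((n : ℝ) + 1)⁻¹)⁻¹ • S with ht
  have hmono : Monotone t := by
    intro m n hmn
    have hle : (1 + ((m : ℝ) + 1)⁻¹)⁻¹ ≤ (1 + ((n : ℝ) + 1)⁻¹)⁻¹ := by gcongr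
    rintro _ ⟨x, hx, rfl⟩
    refine ⟨((1 + ((n : ℝ) + 1)⁻¹) * (1 + ((m : ℝ) + 1)⁻¹)⁻¹) • x,
      hconv.smul_mem_of_zero_mem h0 hx ⟨by positivity, ?_⟩, ?_⟩
    · have := mul_le_mul_of_nonneg_left hle (show (0 : ℝ) ≤ 1 + ((n : ℝ) + 1)⁻¹ by positivity)
      rwa [mul_inv_cancel₀ (by positivity)] at this
    · change _ • _ • x = _ • x
      rw [smul_smul, inv_mul_cancel_left₀ (by positivity)]
  have hunion : interior S ⊆ ⋃ n, t n := by
    intro x hx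
    have hlim : Tendsto (fun n : ℕ => (1 + ((n : ℝ) + 1)⁻¹) • x) atTop (𝓝 x) := by
      have h1 : Tendsto (fun n : ℕ => 1 + ((n : ℝ) + 1)⁻¹) atTop (𝓝 (1 + 0)) :=
        tendsto_const_nhds.add
          (by simpa [one_div] using tendsto_one_div_add_atTop_nhds_zero_nat (𝕜 := ℝ))
      rw [add_zero] at h1
      simpa using h1.smul_const x
    obtain ⟨n, hn⟩ := (hlim.eventually (mem_interior_iff_mem_nhds.1 hx)).exists
    refine mem_iUnion.2 ⟨n, _, hn, ?_⟩
    change _ • _ • x = x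
    rw [smul_smul, inv_mul_cancel₀ (by positivity), one_smul]
  have hlt : y < ⨆ n, radialMeasure φ (t n) := by
    rw [← hmono.measure_iUnion]
    refine lt_of_lt_of_le hy ?_
    change radialMeasure φ (convexHull ℝ (range p)) ≤ _
    rw [← radialMeasure_interior hconv]
    exact measure_mono hunion
  obtain ⟨n, hn⟩ := lt_iSup_iff.1 hlt
  have hε : (0 : ℝ) < ((n : ℝ) + 1)⁻¹ := by positivity
  filter_upwards [self_mem_nhdsWithin,
    mem_nhdsWithin_of_mem_nhds (ball_mem_nhds p (mul_pos hε hρ))] with q hq hqp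
  exact hn.trans_le (measure_mono (smul_convexHull_subset_of_dist_lt hε hq hqp))

theorem exists_isRadialMin [Nonempty ι] {φ : ℝ → ℝ≥0∞} {R ρ : ℝ} (hρ : 0 < ρ)
    (hne : ∃ q : ι → E, closedBall 0 ρ ⊆ convexHull ℝ (range q) ∧ ∀ i, ‖q i‖ ≤ R) :
    ∃ p : ι → E, IsRadialMin φ R ρ p := by
  set K : Set (ι → E) := {p | closedBall 0 ρ ⊆ convexHull ℝ (range p)} ∩
    Set.pi univ fun _ => closedBall 0 R with hK
  have hcomp : IsCompact K :=
    (isCompact_univ_pi fun _ => isCompact_closedBall _ _).inter_left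
      (isClosed_setOf_subset_convexHull_range _)
  have hne' : K.Nonempty := by
    obtain ⟨q, h1, h2⟩ := hne
    exact ⟨q, h1, fun i _ => by simpa using h2 i⟩
  obtain ⟨p, hp, hmin⟩ := LowerSemicontinuousOn.exists_isMinOn hne' hcomp
    ((lowerSemicontinuousOn_radialMeasure_convexHull (φ := φ) hρ).mono inter_subset_left)
  exact ⟨p, hp.1, fun i => by simpa using hp.2 i (mem_univ i),
    fun q hq hR => hmin ⟨hq, fun i _ => by simpa using hR i⟩⟩

end Existence

/-! ### Regular circumscribed simplices against minimizers -/

section Comparison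

open Set Metric Module

variable {E : Type*} [NormedAddCommGroup E] [InnerProductSpace ℝ E] {ι : Type*} [Fintype ι]

theorem AffineBasis.add_inner_eq_sum (b : AffineBasis ι ℝ E) (a : ℝ) (β x : E) :
    a + ⟪β, x⟫ = ∑ k, b.coord k x * (a + ⟪β, b k⟫) := by
  conv_lhs => rw [← b.linear_combination_coord_eq_self x, inner_sum]
  simp only [mul_add, Finset.sum_add_distrib, real_inner_smul_right]
  rw [← Finset.sum_mul, b.sum_coord_apply_eq_one, one_mul]

/-- A facet touching the ball of radius `ρ`, in terms of a multiple of the corresponding barycentric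
coordinate. -/
theorem AffineBasis.touch_of_vanish (b : AffineBasis ι ℝ E) {ρ : ℝ} (hρ : 0 < ρ)
    (hB : closedBall 0 ρ ⊆ convexHull ℝ (range b)) {i : ι} {a : ℝ} {β : E}
    (hi : 0 ≤ a + ⟪β, b i⟫) (hj : ∀ j, j ≠ i → a + ⟪β, b j⟫ = 0)
    (htouch : ∃ z ∈ closedBall (0 : E) ρ, b.coord i z = 0) : a = ρ * ‖β‖ := by
  classical
  have h : ∀ x, a + ⟪β, x⟫ = b.coord i x * (a + ⟪β, b i⟫) := fun x => by
    rw [b.add_inner_eq_sum]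
    exact Finset.sum_eq_single i (fun j _ hji => by rw [hj j hji, mul_zero])
      fun h => absurd (Finset.mem_univ i) h
  obtain ⟨z, hz, hz0⟩ := htouch
  refine (touch_of_nonneg_ball hρ (fun x hx => ?_) hz (by rw [h, hz0, zero_mul])).1
  rw [h]
  have := hB hx
  rw [b.convexHull_eq_nonneg_coord] at this
  exact mul_nonneg (this i) hi

theorem Finset.sum_eq_add_card_mul [DecidableEq ι] {d : ℕ} (hcard : Fintype.card ι = d + 1)
    {f : ι → ℝ} {i : ι} {c : ℝ} (h : ∀ j, j ≠ i → f j = c) : ∑ j, f j = f i + d * c := by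
  rw [← Finset.add_sum_erase _ _ (Finset.mem_univ i),
    Finset.sum_congr rfl fun j hj => h j (Finset.ne_of_mem_erase hj), Finset.sum_const,
    nsmul_eq_mul, Finset.card_erase_of_mem (Finset.mem_univ i), Finset.card_univ, hcard,
    Nat.add_sub_cancel]

/-- For each facet there is an explicit affine function vanishing on it, whose gradient norm is the
same for all facets. Touching makes the constant terms `ρ` times these norms, so they agree too, and
they determine `‖b i‖`. -/
theorem AffineBasis.norm_eq_of_dist_eq_of_touch (b : AffineBasis ι ℝ E) {d : ℕ}
    (hcard : Fintype.card ι = d + 1) {ρ a : ℝ} (hρ : 0 < ρ)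
    (hB : closedBall 0 ρ ⊆ convexHull ℝ (range b))
    (hdist : ∀ i j, i ≠ j → ‖b i - b j‖ = a)
    (htouch : ∀ i, ∃ z ∈ closedBall (0 : E) ρ, b.coord i z = 0) (i j : ι) :
    ‖b i‖ = ‖b j‖ := by
  classical
  set α : ι → ℝ := fun i => ∑ k, ‖b k‖ ^ 2 - (d + 1) * ‖b i‖ ^ 2 + a ^ 2 with hα
  set β : ι → E := fun i => (2 : ℝ) • (((d : ℝ) + 1) • b i - ∑ k, b k) with hβ
  -- The terms in `‖x‖ ^ 2` cancel because there are `d + 1` vertices.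
  have hW : ∀ i x, α i + ⟪β i, x⟫ =
      ∑ k, ‖b k - x‖ ^ 2 - (d + 1) * ‖b i - x‖ ^ 2 + a ^ 2 := by
    intro i x
    simp only [hα, hβ, norm_sub_sq_real, inner_sub_left, real_inner_smul_left, sum_inner,
      Finset.sum_add_distrib, Finset.sum_sub_distrib, ← Finset.mul_sum, Finset.sum_const,
      Finset.card_univ, hcard, nsmul_eq_mul, Nat.cast_add, Nat.cast_one]
    ring
  have hsum : ∀ j, ∑ k, ‖b k - b j‖ ^ 2 = d * a ^ 2 := fun j => by
    rw [Finset.sum_eq_add_card_mul hcard (i := j) (c := a ^ 2)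
      fun k hk => by rw [hdist k j hk], sub_self, norm_zero]
    ring
  have hWi : ∀ i, α i + ⟪β i, b i⟫ = (d + 1) * a ^ 2 := fun i => by
    rw [hW, hsum, sub_self, norm_zero]; ring
  have hWj : ∀ i j, j ≠ i → α i + ⟪β i, b j⟫ = 0 := fun i j hj => by
    rw [hW, hsum, hdist i j hj.symm]; ring
  have ht : ∀ i, α i = ρ * ‖β i‖ := fun i =>
    b.touch_of_vanish hρ hB (by rw [hWi]; positivity) (hWj i) (htouch i)
  have hnorm : ∀ i, ‖β i‖ ^ 2 = 2 * (d + 1) * d * a ^ 2 := fun i => by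
    have h1 : ∑ k, (α i + ⟪β i, b k⟫) = (d + 1) * a ^ 2 := by
      rw [Finset.sum_eq_add_card_mul hcard (i := i) (hWj i), hWi]; ring
    rw [Finset.sum_add_distrib, Finset.sum_const, Finset.card_univ, hcard, nsmul_eq_mul,
      Nat.cast_add, Nat.cast_one, ← inner_sum] at h1
    have h2 := hWi i
    have h3 : ‖β i‖ ^ 2 = 2 * ((d + 1) * ⟪β i, b i⟫ - ⟪β i, ∑ k, b k⟫) := by
      rw [← real_inner_self_eq_norm_sq]
      nth_rewrite 2 [hβ]
      rw [real_inner_smul_right, inner_sub_right, real_inner_smul_right]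
    rw [h3]
    linear_combination 2 * (d + 1 : ℝ) * h2 - 2 * h1
  have hβij : ‖β i‖ = ‖β j‖ := by
    rw [← sq_eq_sq₀ (norm_nonneg _) (norm_nonneg _), hnorm, hnorm]
  have hαij : α i = α j := by rw [ht, ht, hβij]
  rw [← sq_eq_sq₀ (norm_nonneg _) (norm_nonneg _)]
  have hd : (0 : ℝ) < d + 1 := by positivity
  refine mul_left_cancel₀ hd.ne' ?_
  simp only [hα] at hαij
  linarith

/-- The Lorentzian counterpart: `(γ i, γ i • b i)` are points of the hyperboloid with constant
mutual Lorentz products `C`, and `α i + ⟪β i, x⟫` is a combination of Lorentz products which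
vanishes at the vertices other than `b i`. -/
theorem AffineBasis.norm_eq_of_lorentz_eq_of_touch (b : AffineBasis ι ℝ E) {d : ℕ}
    (hcard : Fintype.card ι = d + 1) {ρ C : ℝ} (hρ : 0 < ρ) (hρ1 : ρ < 1) (hC : 1 ≤ C)
    {γ : ι → ℝ} (hγ : ∀ i, 0 < γ i) (hself : ∀ i, γ i * γ i * (1 - ⟪b i, b i⟫) = 1)
    (hne : ∀ i j, i ≠ j → γ i * γ j * (1 - ⟪b i, b j⟫) = C)
    (hB : closedBall 0 ρ ⊆ convexHull ℝ (range b))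
    (htouch : ∀ i, ∃ z ∈ closedBall (0 : E) ρ, b.coord i z = 0) (i j : ι) :
    γ i = γ j := by
  classical
  set α : ι → ℝ := fun i => C * ∑ k, γ k - (1 + d * C) * γ i with hα
  set β : ι → E := fun i => (1 + d * C) • γ i • b i - C • ∑ k, γ k • b k with hβ
  have hdC : 0 < 1 + d * C := by positivity
  have hW : ∀ i x, α i + ⟪β i, x⟫ =
      C * ∑ k, γ k * (1 - ⟪b k, x⟫) - (1 + d * C) * (γ i * (1 - ⟪b i, x⟫)) := by
    intro i x
    simp only [hα, hβ, inner_sub_left, real_inner_smul_left, sum_inner, mul_sub,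
      Finset.sum_sub_distrib, mul_one]
    ring
  have hsum : ∀ j, γ j * ∑ k, γ k * (1 - ⟪b k, b j⟫) = 1 + d * C := fun j => by
    rw [Finset.mul_sum, Finset.sum_eq_add_card_mul hcard (i := j) (c := C)
      fun k hk => by rw [← hne k j hk]; ring]
    linear_combination hself j
  have hWi : ∀ i, γ i * (α i + ⟪β i, b i⟫) = (1 + d * C) * (C - 1) := fun i => by
    rw [hW]
    linear_combination C * hsum i - (1 + d * C) * hself i
  have hWj : ∀ i j, j ≠ i → γ j * (α i + ⟪β i, b j⟫) = 0 := fun i j hj => by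
    rw [hW]
    linear_combination C * hsum j - (1 + d * C) * hne i j hj.symm
  have ht : ∀ i, α i = ρ * ‖β i‖ := fun i =>
    b.touch_of_vanish hρ hB
      (nonneg_of_mul_nonneg_right
        (by rw [hWi]; exact mul_nonneg hdC.le (by linarith)) (hγ i))
      (fun j hj => (mul_eq_zero.1 (hWj i j hj)).resolve_left (hγ j).ne') (htouch i)
  -- The Lorentz norm of the facet normal is independent of `i`; with `α i = ρ * ‖β i‖` and `ρ < 1`
  -- so is `‖β i‖`.
  have hnorm : ∀ i, α i ^ 2 - ‖β i‖ ^ 2 = (C - (1 + d * C)) * ((1 + d * C) * (C - 1)) :=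
    fun i => by
    have h1 : ∑ k, γ k * (α i + ⟪β i, b k⟫) = (1 + d * C) * (C - 1) := by
      rw [Finset.sum_eq_add_card_mul hcard (i := i) (hWj i), hWi]; ring
    have h1' : ∑ k, γ k * (α i + ⟪β i, b k⟫) = α i * ∑ k, γ k + ⟪β i, ∑ k, γ k • b k⟫ := by
      simp only [mul_add, Finset.sum_add_distrib, inner_sum, real_inner_smul_right,
        ← Finset.sum_mul]
      ring
    have h3 : ‖β i‖ ^ 2 = (1 + d * C) * (γ i * ⟪β i, b i⟫) - C * ⟪β i, ∑ k, γ k • b k⟫ := by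
      rw [← real_inner_self_eq_norm_sq]
      nth_rewrite 2 [hβ]
      rw [inner_sub_right, real_inner_smul_right, real_inner_smul_right, real_inner_smul_right]
    have h4 : α i = C * ∑ k, γ k - (1 + d * C) * γ i := rfl
    rw [h1'] at h1
    linear_combination C * h1 - h3 - (1 + d * C) * hWi i + α i * h4
  have hβij : ‖β i‖ = ‖β j‖ := by
    have h1 := hnorm i
    have h2 := hnorm j
    rw [ht] at h1 h2
    rw [← sq_eq_sq₀ (norm_nonneg _) (norm_nonneg _)]
    have h3 : (1 - ρ ^ 2) * ‖β i‖ ^ 2 = (1 - ρ ^ 2) * ‖β j‖ ^ 2 := by linarith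
    exact mul_left_cancel₀ (by nlinarith) h3
  have hαij : α i = α j := by rw [ht, ht, hβij]
  refine mul_left_cancel₀ hdC.ne' ?_
  simp only [hα] at hαij
  linarith

variable [FiniteDimensional ℝ E] [MeasurableSpace E] [BorelSpace E]

/-- A minimizer under a norm bound satisfied by `q` has the Gram matrix of `p`, so it is a linear
isometric copy of `p`. -/
theorem radialMeasure_le_of_inner_eq [DecidableEq ι] {d : ℕ} (hd : 1 ≤ d) (hdim : finrank ℝ E = d)
    (hcard : Fintype.card ι = d + 1) {φ : ℝ → ℝ≥0∞} (hφ : Monotone φ) (h0 : φ 0 ≠ 0) {ρ : ℝ}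
    (hρ : 0 < ρ) {p q : ι → E} (hp : closedBall 0 ρ ⊆ convexHull ℝ (range p))
    (hinner : ∀ i j, ⟪p i, p j⟫ = if i = j then (d * ρ) ^ 2 else -(d * ρ ^ 2))
    (hq : closedBall 0 ρ ⊆ convexHull ℝ (range q)) :
    radialMeasure φ (convexHull ℝ (range p)) ≤ radialMeasure φ (convexHull ℝ (range q)) := by
  have : Nonempty ι := Fintype.card_pos_iff.1 (by omega)
  have hqR : ∀ i, ‖q i‖ ≤ ∑ j, ‖q j‖ := fun i =>
    Finset.single_le_sum (f := fun j => ‖q j‖) (fun j _ => norm_nonneg _) (Finset.mem_univ i)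
  rcases eq_or_ne (radialMeasure φ (convexHull ℝ (range q))) ∞ with hfin | hfin
  · rw [hfin]; exact le_top
  obtain ⟨m, hm⟩ := exists_isRadialMin (φ := φ) hρ ⟨q, hq, hqR⟩
  have hle := hm.measure_le q hq hqR
  have hinner' := hm.inner_eq hd hdim hcard hφ h0 hρ (ne_top_of_le_ne_top hfin hle)
  obtain ⟨L, hL⟩ := exists_linearIsometryEquiv_of_inner_eq (by rw [hdim, hcard]) hρ hp
    fun i j => (hinner i j).trans (hinner' i j).symm
  rw [← L.radialMeasure_convexHull hφ p, show L ∘ p = m from funext hL]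
  exact hle

end Comparison

/-! ### Invariance under isometries -/

section Transport

open Set Metric

variable {M : Type*} [MetricSpace M] {n : ℕ}

theorem IsometryEquiv.isGeodesicallyConvex_image (e : M ≃ᵢ M) {K : Set M}
    (hK : IsGeodesicallyConvex K) : IsGeodesicallyConvex (e '' K) := by
  rintro _ ⟨p, hp, rfl⟩ _ ⟨q, hq, rfl⟩ x hx
  refine ⟨e.symm x, hK p hp q hq ?_, e.apply_symm_apply x⟩
  have h1 := e.dist_eq p (e.symm x)
  have h2 := e.dist_eq (e.symm x) q
  rw [e.apply_symm_apply] at h1 h2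
  change dist p (e.symm x) + dist (e.symm x) q = dist p q
  rw [← h1, ← h2, ← e.dist_eq p q]
  exact hx

theorem IsometryEquiv.geodesicHull_image_subset (e : M ≃ᵢ M) (X : Set M) :
    geodesicHull (e '' X) ⊆ e '' geodesicHull X := by
  intro x hx
  refine ⟨e.symm x, ?_, e.apply_symm_apply x⟩
  rintro K ⟨hK, hX⟩
  obtain ⟨y, hy, rfl⟩ := hx (e '' K) ⟨e.isGeodesicallyConvex_image hK, image_mono hX⟩
  rwa [e.symm_apply_apply]

theorem IsometryEquiv.geodesicHull_image (e : M ≃ᵢ M) (X : Set M) :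
    geodesicHull (e '' X) = e '' geodesicHull X := by
  refine (e.geodesicHull_image_subset X).antisymm ?_
  have h := e.symm.geodesicHull_image_subset (e '' X)
  rw [← image_comp] at h
  simp only [IsometryEquiv.symm_comp_self, image_id] at h
  rintro _ ⟨x, hx, rfl⟩
  obtain ⟨y, hy, rfl⟩ := h hx
  rwa [e.apply_symm_apply]

theorem IsometryEquiv.simplexBody_comp (e : M ≃ᵢ M) (p : Fin (n + 1) → M) :
    simplexBody (e ∘ p) = e '' simplexBody p := by
  rw [simplexBody, range_comp, e.geodesicHull_image, simplexBody]

theorem IsometryEquiv.simplexFacet_comp (e : M ≃ᵢ M) (p : Fin (n + 1) → M) (i : Fin (n + 1)) :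
    simplexFacet (e ∘ p) i = e '' simplexFacet p i := by
  rw [simplexFacet, image_comp, e.geodesicHull_image, simplexFacet]

theorem IsSimplex.comp (e : M ≃ᵢ M) {p : Fin (n + 1) → M} (hp : IsSimplex p) :
    IsSimplex (e ∘ p) := by
  have h := e.toHomeomorph.image_interior (simplexBody p)
  change e '' _ = interior (e '' _) at h
  rw [IsSimplex, e.simplexBody_comp, ← h]
  exact hp.image _

theorem IsRegularSimplex.comp (e : M ≃ᵢ M) {p : Fin (n + 1) → M} (hp : IsRegularSimplex p) :
    IsRegularSimplex (e ∘ p) := by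
  refine ⟨hp.1.comp e, fun σ => ?_⟩
  obtain ⟨f, hf⟩ := hp.2 σ
  exact ⟨(e.symm.trans f).trans e, fun i => by simp [hf]⟩

theorem IsCircumscribedAbout.comp (e : M ≃ᵢ M) {p : Fin (n + 1) → M} {B : Set M}
    (hp : IsCircumscribedAbout p B) : IsCircumscribedAbout (e ∘ p) (e '' B) := by
  refine ⟨by rw [e.simplexBody_comp]; exact image_mono hp.1, fun i => ?_⟩
  rw [e.simplexFacet_comp, ← image_inter e.injective]
  exact (hp.2 i).image _

theorem IsMinVolSimplexContaining.comp [MeasurableSpace M] {μ : Measure M} (e : M ≃ᵢ M)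
    (hμ : ∀ q : Fin (n + 1) → M, μ (simplexBody (e ∘ q)) = μ (simplexBody q))
    {p : Fin (n + 1) → M} {B : Set M} (hp : IsMinVolSimplexContaining μ p B) :
    IsMinVolSimplexContaining μ (e ∘ p) (e '' B) := by
  refine ⟨hp.1.comp e, by rw [e.simplexBody_comp]; exact image_mono hp.2.1, fun q hq hB => ?_⟩
  have he : e ∘ (e.symm ∘ q) = q := by ext; simp
  rw [hμ, ← he, hμ]
  refine hp.2.2 _ (hq.comp e.symm) ?_
  rw [e.symm.simplexBody_comp]
  intro x hx
  exact ⟨e x, hB ⟨x, hx, rfl⟩, e.symm_apply_apply x⟩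

theorem minVol_iff_regular_of_image [MeasurableSpace M] {μ : Measure M} (e : M ≃ᵢ M)
    (hμ : ∀ q : Fin (n + 1) → M, μ (simplexBody (e ∘ q)) = μ (simplexBody q)) {B B' : Set M}
    (hB : e '' B = B')
    (h : ∀ p : Fin (n + 1) → M, IsMinVolSimplexContaining μ p B ↔
      IsRegularSimplex p ∧ IsCircumscribedAbout p B) (p : Fin (n + 1) → M) :
    IsMinVolSimplexContaining μ p B' ↔ IsRegularSimplex p ∧ IsCircumscribedAbout p B' := by
  have he : ∀ q : Fin (n + 1) → M, e ∘ (e.symm ∘ q) = q := fun q => by ext; simp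
  have hB' : e.symm '' B' = B := by
    rw [← hB, ← image_comp]; simp
  constructor
  · intro hp
    have h1 := hp.comp e.symm fun q => by rw [← hμ, he]
    rw [hB', h] at h1
    have h2 := h1.1.comp e
    have h3 := h1.2.comp e
    rw [he] at h2 h3
    exact ⟨h2, hB ▸ h3⟩
  · rintro ⟨h1, h2⟩
    have h3 := h2.comp e.symm
    rw [hB'] at h3
    have h4 := ((h _).2 ⟨h1.comp e.symm, h3⟩).comp e hμ
    rwa [he, hB] at h4

theorem IsRegularSimplex.exists_dist_eq {p : Fin (n + 1) → M} (hp : IsRegularSimplex p) :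
    ∃ a, ∀ i j, i ≠ j → dist (p i) (p j) = a := by
  by_cases hex : ∃ k l : Fin (n + 1), k ≠ l
  · obtain ⟨k, l, hkl⟩ := hex
    refine ⟨dist (p k) (p l), fun i j hij => ?_⟩
    -- This permutation sends `i` to `k` and `j` to `l`.
    obtain ⟨f, hf⟩ := hp.2 (Equiv.swap (Equiv.swap i k j) l * Equiv.swap i k)
    rw [← f.dist_eq, hf, hf, Equiv.Perm.mul_apply, Equiv.Perm.mul_apply, Equiv.swap_apply_left,
      Equiv.swap_apply_left, Equiv.swap_apply_of_ne_of_ne _ hkl]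
    intro h
    have := congrArg (Equiv.swap i k) h
    rw [Equiv.swap_apply_right, Equiv.swap_apply_self] at this
    exact hij this
  · push Not at hex
    exact ⟨0, fun i j hij => absurd (hex i j) hij⟩

end Transport

/-! ### The Euclidean case -/

section Euclidean

open Set Metric Module

variable {d : ℕ}

theorem isGeodesicallyConvex_iff_convex {K : Set (EuclideanSpace ℝ (Fin d))} :
    IsGeodesicallyConvex K ↔ Convex ℝ K := by
  have h : ∀ p q : EuclideanSpace ℝ (Fin d), geodesicSegment p q = segment ℝ p q := by
    intro p q
    ext x
    rw [mem_segment_iff_wbtw, ← dist_add_dist_eq_iff]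
    rfl
  rw [convex_iff_segment_subset, IsGeodesicallyConvex]
  simp only [h]

theorem geodesicHull_eq_convexHull (X : Set (EuclideanSpace ℝ (Fin d))) :
    geodesicHull X = convexHull ℝ X := by
  ext x
  rw [mem_convexHull_iff, geodesicHull, mem_sInter]
  simp only [isGeodesicallyConvex_iff_convex]
  exact ⟨fun h K hX hK => h K ⟨hK, hX⟩, fun h K hK => h K hK.2 hK.1⟩

theorem simplexBody_eq_convexHull (p : Fin (d + 1) → EuclideanSpace ℝ (Fin d)) :
    simplexBody p = convexHull ℝ (range p) := geodesicHull_eq_convexHull _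

theorem isSimplex_of_ball_subset {ρ : ℝ} (hρ : 0 < ρ) {p : Fin (d + 1) → EuclideanSpace ℝ (Fin d)}
    (hp : closedBall 0 ρ ⊆ convexHull ℝ (range p)) : IsSimplex p := by
  rw [IsSimplex, simplexBody_eq_convexHull]
  exact ⟨0, interior_mono hp (by rw [interior_closedBall _ hρ.ne']; simpa using hρ)⟩

theorem exists_ball_subset_convexHull (ρ : ℝ) :
    ∃ p : Fin (d + 1) → EuclideanSpace ℝ (Fin d), closedBall 0 ρ ⊆ convexHull ℝ (range p) := by
  obtain ⟨b⟩ := AffineBasis.exists_affineBasis_of_finiteDimensional (k := ℝ) (ι := Fin (d + 1))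
    (P := EuclideanSpace ℝ (Fin d)) (by simp)
  have hint := interior_convexHull_nonempty_iff_affineSpan_eq_top.2 b.tot
  obtain ⟨c, hc⟩ := hint
  obtain ⟨δ, hδ, hball⟩ := Metric.isOpen_iff.1 isOpen_interior c hc
  set f : EuclideanSpace ℝ (Fin d) →ᵃ[ℝ] EuclideanSpace ℝ (Fin d) :=
    ((|ρ| + 1) / δ) • (AffineMap.id ℝ _ - AffineMap.const ℝ _ c) with hf
  refine ⟨f ∘ b, fun x hx => ?_⟩
  rw [range_comp, ← AffineMap.image_convexHull]
  have hpos : 0 < |ρ| + 1 := by positivity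
  refine ⟨c + (δ / (|ρ| + 1)) • x, interior_subset (hball ?_), ?_⟩
  · rw [mem_closedBall_zero_iff] at hx
    rw [mem_ball, dist_eq_norm, add_sub_cancel_left, norm_smul, Real.norm_eq_abs,
      abs_of_pos (by positivity), div_mul_eq_mul_div, div_lt_iff₀ hpos]
    have := le_abs_self ρ
    gcongr
    linarith
  · change ((|ρ| + 1) / δ) • (c + (δ / (|ρ| + 1)) • x - c) = x
    rw [add_sub_cancel_left, smul_smul]
    rw [div_mul_div_cancel₀ hδ.ne', div_self hpos.ne', one_smul]

theorem radialMeasure_one {E : Type*} [NormedAddCommGroup E] [InnerProductSpace ℝ E]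
    [FiniteDimensional ℝ E] [MeasurableSpace E] [BorelSpace E] :
    radialMeasure (fun _ => 1) = (volume : Measure E) := by
  rw [radialMeasure]; exact withDensity_one

/-- A simplex whose Gram matrix is that of a centred regular simplex is symmetric under all
permutations of its vertices. -/
theorem exists_linearIsometryEquiv_perm {ρ : ℝ} (hρ : 0 < ρ)
    {p : Fin (d + 1) → EuclideanSpace ℝ (Fin d)}
    (hp : closedBall 0 ρ ⊆ convexHull ℝ (range p))
    (hinner : ∀ i j, ⟪p i, p j⟫ = if i = j then (d * ρ) ^ 2 else -(d * ρ ^ 2))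
    (σ : Equiv.Perm (Fin (d + 1))) :
    ∃ L : EuclideanSpace ℝ (Fin d) ≃ₗᵢ[ℝ] EuclideanSpace ℝ (Fin d), ∀ i, L (p i) = p (σ i) :=
  exists_linearIsometryEquiv_of_inner_eq (q := p ∘ σ) (by simp) hρ hp fun i j => by
    rw [hinner, Function.comp, Function.comp, hinner]
    simp

theorem euclidean_minVol_centered (hd : 1 ≤ d) {ρ : ℝ} (hρ : 0 < ρ) :
    (∃ p : Fin (d + 1) → EuclideanSpace ℝ (Fin d),
      IsMinVolSimplexContaining volume p (closedBall 0 ρ)) ∧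
    ∀ p : Fin (d + 1) → EuclideanSpace ℝ (Fin d),
      IsMinVolSimplexContaining volume p (closedBall 0 ρ) ↔
        IsRegularSimplex p ∧ IsCircumscribedAbout p (closedBall 0 ρ) := by
  have hdim : finrank ℝ (EuclideanSpace ℝ (Fin d)) = d := by simp
  have hcard : Fintype.card (Fin (d + 1)) = d + 1 := by simp
  have hφ : Monotone fun _ : ℝ => (1 : ℝ≥0∞) := monotone_const
  have hfin : ∀ q : Fin (d + 1) → EuclideanSpace ℝ (Fin d),
      radialMeasure (fun _ => 1) (convexHull ℝ (range q)) ≠ ∞ := fun q => by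
    rw [radialMeasure_one]
    exact (isCompact_convexHull_range q).measure_lt_top.ne
  have hbound : ∀ (q : Fin (d + 1) → EuclideanSpace ℝ (Fin d)) i, ‖q i‖ ≤ ∑ j, ‖q j‖ :=
    fun q i => Finset.single_le_sum (f := fun j => ‖q j‖) (fun j _ => norm_nonneg _)
      (Finset.mem_univ i)
  have hmin : ∀ p : Fin (d + 1) → EuclideanSpace ℝ (Fin d),
      closedBall 0 ρ ⊆ convexHull ℝ (range p) →
      (∀ i j, ⟪p i, p j⟫ = if i = j then (d * ρ) ^ 2 else -(d * ρ ^ 2)) →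
      IsMinVolSimplexContaining volume p (closedBall 0 ρ) := by
    intro p hp hinner
    refine ⟨isSimplex_of_ball_subset hρ hp, by rwa [simplexBody_eq_convexHull], fun q _ hq => ?_⟩
    rw [simplexBody_eq_convexHull] at hq
    rw [simplexBody_eq_convexHull, simplexBody_eq_convexHull, ← radialMeasure_one]
    exact radialMeasure_le_of_inner_eq hd hdim hcard hφ one_ne_zero hρ hp hinner hq
  refine ⟨?_, fun p => ⟨fun hp => ?_, fun ⟨hreg, hcirc⟩ => ?_⟩⟩
  · obtain ⟨q, hq⟩ := exists_ball_subset_convexHull (d := d) ρ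
    obtain ⟨p, hp⟩ := exists_isRadialMin (φ := fun _ => 1) hρ ⟨q, hq, hbound q⟩
    exact ⟨p, hmin p hp.ball_subset (hp.inner_eq hd hdim hcard hφ one_ne_zero hρ (hfin p))⟩
  · have hpB := hp.2.1
    rw [simplexBody_eq_convexHull] at hpB
    -- Minimality of `p` is unrestricted, so any bound on its vertices serves as `R`.
    have hrad : IsRadialMin (fun _ => 1) (∑ j, ‖p j‖) ρ p := ⟨hpB, hbound p, fun q hq _ => by
      rw [radialMeasure_one, ← simplexBody_eq_convexHull, ← simplexBody_eq_convexHull]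
      exact hp.2.2 q (isSimplex_of_ball_subset hρ hq) (by rwa [simplexBody_eq_convexHull])⟩
    have hinner := hrad.inner_eq hd hdim hcard hφ one_ne_zero hρ (hfin p)
    refine ⟨⟨hp.1, fun σ => ?_⟩, hp.2.1, fun i => ?_⟩
    · obtain ⟨L, hL⟩ := exists_linearIsometryEquiv_perm hρ hpB hinner σ
      exact ⟨L.toIsometryEquiv, hL⟩
    · have : Nontrivial (Fin (d + 1)) := Fin.nontrivial_iff_two_le.2 (by omega)
      obtain ⟨z, hz, hz'⟩ := hrad.exists_mem_facet (by simp) hφ one_ne_zero hρ (hfin p) i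
      exact ⟨z, by rwa [simplexFacet, geodesicHull_eq_convexHull], hz⟩
  · have hpB := hcirc.1
    rw [simplexBody_eq_convexHull] at hpB
    refine hmin p hpB ?_
    obtain ⟨a, ha⟩ := hreg.exists_dist_eq
    have hfacet := hcirc.2
    obtain ⟨b, rfl⟩ := exists_affineBasis_of_ball_subset (by simp) hρ hpB
    have htouch : ∀ i, ∃ z ∈ closedBall (0 : EuclideanSpace ℝ (Fin d)) ρ, b.coord i z = 0 := by
      intro i
      obtain ⟨z, hz, hzB⟩ := hfacet i
      rw [simplexFacet, geodesicHull_eq_convexHull] at hz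
      exact ⟨z, hzB, ((b.mem_convexHull_image_ne_iff i z).1 hz).2⟩
    simp only [dist_eq_norm] at ha
    have hnorm := b.norm_eq_of_dist_eq_of_touch hcard hρ hpB ha htouch
    refine b.inner_eq_of_balanced hd hcard hρ hpB hnorm (fun i j k hki hkj => ?_) ⟨0, htouch 0⟩
    have h1 := norm_sub_sq_real (b k) (b i)
    have h2 := norm_sub_sq_real (b k) (b j)
    rw [ha k i hki] at h1
    rw [ha k j hkj, hnorm j i] at h2
    linarith

theorem euclidean_minVol (hd : 1 ≤ d) (c : EuclideanSpace ℝ (Fin d)) {r : ℝ} (hr : 0 < r) :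
    (∃ p : Fin (d + 1) → EuclideanSpace ℝ (Fin d),
      IsMinVolSimplexContaining volume p (closedBall c r)) ∧
    ∀ p : Fin (d + 1) → EuclideanSpace ℝ (Fin d),
      IsMinVolSimplexContaining volume p (closedBall c r) ↔
        IsRegularSimplex p ∧ IsCircumscribedAbout p (closedBall c r) := by
  obtain ⟨⟨p, hp⟩, h⟩ := euclidean_minVol_centered hd hr
  set e : EuclideanSpace ℝ (Fin d) ≃ᵢ EuclideanSpace ℝ (Fin d) := IsometryEquiv.addRight c with he
  have hB : e '' closedBall 0 r = closedBall c r := by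
    rw [e.image_closedBall]; simp [he]
  have hμ : ∀ q : Fin (d + 1) → EuclideanSpace ℝ (Fin d),
      volume (simplexBody (e ∘ q)) = volume (simplexBody q) := fun q => by
    rw [e.simplexBody_comp]
    change volume ((fun x => x + c) '' _) = _
    rw [image_add_right, measure_preimage_add_right]
  exact ⟨⟨e ∘ p, hB ▸ hp.comp e hμ⟩, minVol_iff_regular_of_image e hμ hB h⟩

end Euclidean

/-! ### Point reflections in the projective ball model -/

section KleinInvolution

open Set Metric Module

theorem klein_sqrt_pos {E : Type*} [NormedAddCommGroup E] {c : E} (hc : ‖c‖ < 1) :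
    0 < √(1 - ‖c‖ ^ 2) :=
  Real.sqrt_pos.2 (by nlinarith [norm_nonneg c])

theorem klein_norm_sq {E : Type*} [NormedAddCommGroup E] {c : E} (hc : ‖c‖ < 1) :
    ‖c‖ ^ 2 = 1 - √(1 - ‖c‖ ^ 2) ^ 2 := by
  rw [Real.sq_sqrt (by nlinarith [norm_nonneg c])]; ring

variable {E : Type*} [NormedAddCommGroup E] [InnerProductSpace ℝ E]

/-- The linear map `x ↦ s x + (1 + s)⁻¹ ⟪c, x⟫ c`, where `s = √(1 - ‖c‖²)`. -/
noncomputable def kleinLinear (c : E) : E →ₗ[ℝ] E :=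
  √(1 - ‖c‖ ^ 2) • LinearMap.id +
    (1 + √(1 - ‖c‖ ^ 2))⁻¹ • (innerₗ E c).smulRight c

/-- In the projective ball model, the point reflection in the midpoint of `0` and `c`. -/
noncomputable def kleinInvolution (c x : E) : E :=
  (1 - ⟪c, x⟫)⁻¹ • (c - kleinLinear c x)

theorem kleinLinear_apply (c x : E) : kleinLinear c x =
    √(1 - ‖c‖ ^ 2) • x + ((1 + √(1 - ‖c‖ ^ 2))⁻¹ * ⟪c, x⟫) • c := by
  simp [kleinLinear, smul_smul]

variable {c : E}

theorem one_sub_inner_pos_of_norm_lt_one {x : E} (hc : ‖c‖ < 1) (hx : ‖x‖ < 1) :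
    0 < 1 - ⟪c, x⟫ := by
  have h := real_inner_le_norm c x
  nlinarith [norm_nonneg c, norm_nonneg x]

/-- `kleinLinear c` is self-adjoint: it fixes `c` and scales the orthogonal complement of `c` by
`√(1 - ‖c‖ ^ 2)`. -/
theorem inner_kleinLinear (hc : ‖c‖ < 1) (x : E) : ⟪c, kleinLinear c x⟫ = ⟪c, x⟫ := by
  have hs := klein_sqrt_pos hc
  rw [kleinLinear_apply, inner_add_right, real_inner_smul_right, real_inner_smul_right,
    real_inner_self_eq_norm_sq]
  nth_rewrite 3 [klein_norm_sq hc]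
  field_simp
  ring

theorem kleinLinear_self (hc : ‖c‖ < 1) : kleinLinear c c = c := by
  have hs := klein_sqrt_pos hc
  rw [kleinLinear_apply, real_inner_self_eq_norm_sq, ← add_smul]
  nth_rewrite 3 [klein_norm_sq hc]
  rw [show √(1 - ‖c‖ ^ 2) + (1 + √(1 - ‖c‖ ^ 2))⁻¹ * (1 - √(1 - ‖c‖ ^ 2) ^ 2) = 1 by
    field_simp; ring, one_smul]

theorem kleinLinear_kleinLinear (hc : ‖c‖ < 1) (x : E) :
    kleinLinear c (kleinLinear c x) = (1 - ‖c‖ ^ 2) • x + ⟪c, x⟫ • c := by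
  have hs := klein_sqrt_pos hc
  have hs2 := Real.sq_sqrt (show 0 ≤ 1 - ‖c‖ ^ 2 by nlinarith [norm_nonneg c])
  conv_lhs => rw [kleinLinear_apply c x]
  rw [map_add, map_smul, map_smul, kleinLinear_self hc, kleinLinear_apply, smul_add, smul_smul,
    smul_smul, add_assoc, ← add_smul, ← sq, hs2]
  congr 2
  field_simp
  ring

theorem inner_kleinLinear_kleinLinear (hc : ‖c‖ < 1) (x y : E) :
    ⟪kleinLinear c x, kleinLinear c y⟫ = (1 - ‖c‖ ^ 2) * ⟪x, y⟫ + ⟪c, x⟫ * ⟪c, y⟫ := by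
  have hsymm : ∀ z, ⟪kleinLinear c x, z⟫ = ⟪x, kleinLinear c z⟫ := fun z => by
    simp only [kleinLinear_apply, inner_add_left, inner_add_right, real_inner_smul_left,
      real_inner_smul_right]
    rw [real_inner_comm c x]
    ring
  rw [hsymm, kleinLinear_kleinLinear hc, inner_add_right, real_inner_smul_right,
    real_inner_smul_right, real_inner_comm x c]
  ring

theorem kleinLinear_injective (hc : ‖c‖ < 1) : Function.Injective (kleinLinear c) := by
  rw [← LinearMap.ker_eq_bot, LinearMap.ker_eq_bot']
  intro x hx
  have h := inner_kleinLinear_kleinLinear hc x x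
  rw [hx, inner_zero_left, real_inner_self_eq_norm_sq] at h
  have h1 : 0 < 1 - ‖c‖ ^ 2 := by nlinarith [norm_nonneg c]
  have h2 : ‖x‖ ^ 2 = 0 := by
    have := mul_nonneg h1.le (sq_nonneg ‖x‖)
    have h3 : (1 - ‖c‖ ^ 2) * ‖x‖ ^ 2 = 0 := by nlinarith [mul_self_nonneg ⟪c, x⟫]
    exact (mul_eq_zero.1 h3).resolve_left h1.ne'
  simpa using h2

/-- In homogeneous coordinates the involution is the linear map taking `(1, x)` to `(1 - ⟪c, x⟫, c -
kleinLinear c x)`, which multiplies the Lorentz form by `1 - ‖c‖ ^ 2`. -/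
theorem one_sub_inner_kleinInvolution (hc : ‖c‖ < 1) {x y : E} (hx : ‖x‖ < 1) (hy : ‖y‖ < 1) :
    1 - ⟪kleinInvolution c x, kleinInvolution c y⟫ =
      (1 - ‖c‖ ^ 2) * (1 - ⟪x, y⟫) / ((1 - ⟪c, x⟫) * (1 - ⟪c, y⟫)) := by
  have h1 := one_sub_inner_pos_of_norm_lt_one hc hx
  have h2 := one_sub_inner_pos_of_norm_lt_one hc hy
  rw [kleinInvolution, kleinInvolution, real_inner_smul_left, real_inner_smul_right,
    inner_sub_left, inner_sub_right, inner_sub_right, real_inner_comm c (kleinLinear c x),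
    inner_kleinLinear hc, inner_kleinLinear hc, inner_kleinLinear_kleinLinear hc,
    real_inner_self_eq_norm_sq]
  field_simp
  ring

theorem one_sub_norm_kleinInvolution (hc : ‖c‖ < 1) {x : E} (hx : ‖x‖ < 1) :
    1 - ‖kleinInvolution c x‖ ^ 2 =
      (1 - ‖c‖ ^ 2) * (1 - ‖x‖ ^ 2) / (1 - ⟪c, x⟫) ^ 2 := by
  rw [← real_inner_self_eq_norm_sq, one_sub_inner_kleinInvolution hc hx hx,
    real_inner_self_eq_norm_sq x, sq (1 - ⟪c, x⟫)]

theorem norm_kleinInvolution_lt_one (hc : ‖c‖ < 1) {x : E} (hx : ‖x‖ < 1) :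
    ‖kleinInvolution c x‖ < 1 := by
  have h := one_sub_norm_kleinInvolution hc hx
  have h1 := one_sub_inner_pos_of_norm_lt_one hc hx
  have h2 : 0 < 1 - ‖c‖ ^ 2 := by nlinarith [norm_nonneg c]
  have h3 : 0 < 1 - ‖x‖ ^ 2 := by nlinarith [norm_nonneg x]
  have h4 : 0 < 1 - ‖kleinInvolution c x‖ ^ 2 := by rw [h]; positivity
  nlinarith [norm_nonneg (kleinInvolution c x)]

theorem kleinInvolution_kleinInvolution (hc : ‖c‖ < 1) {x : E} (hx : ‖x‖ < 1) :
    kleinInvolution c (kleinInvolution c x) = x := by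
  have h1 := one_sub_inner_pos_of_norm_lt_one hc hx
  have h2 : 0 < 1 - ‖c‖ ^ 2 := by nlinarith [norm_nonneg c]
  have h3 : 1 - ⟪c, kleinInvolution c x⟫ = (1 - ‖c‖ ^ 2) / (1 - ⟪c, x⟫) := by
    rw [kleinInvolution, real_inner_smul_right, inner_sub_right, inner_kleinLinear hc,
      real_inner_self_eq_norm_sq]
    field_simp
    ring
  rw [kleinInvolution, h3]
  rw [kleinInvolution, map_smul, map_sub, kleinLinear_self hc, kleinLinear_kleinLinear hc]
  rw [inv_smul_eq_iff₀ (by positivity)]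
  rw [← smul_right_inj h1.ne', smul_sub, smul_smul, smul_smul, mul_inv_cancel₀ h1.ne',
    mul_div_cancel₀ _ h1.ne']
  module

theorem kleinInvolution_zero (c : E) : kleinInvolution c 0 = c := by
  simp [kleinInvolution]

theorem kleinInvolution_eq_smul (hc : ‖c‖ < 1) (x : E) :
    kleinInvolution c x = (1 - ⟪c, x⟫)⁻¹ • kleinLinear c (c - x) := by
  rw [kleinInvolution, map_sub, kleinLinear_self hc]

theorem kleinInvolution_self (hc : ‖c‖ < 1) : kleinInvolution c c = 0 := by
  rw [kleinInvolution_eq_smul hc, sub_self, map_zero, smul_zero]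

/-- The derivative of `kleinInvolution`. -/
noncomputable def kleinDeriv (c x : E) : E →ₗ[ℝ] E :=
  (-(1 - ⟪c, x⟫)⁻¹) • kleinLinear c ∘ₗ
    LinearMap.transvection ((-(1 - ⟪c, x⟫)⁻¹) • innerₗ E c) (c - x)

theorem kleinDeriv_apply (hc : ‖c‖ < 1) (x v : E) : kleinDeriv c x v =
    (1 - ⟪c, x⟫)⁻¹ • (-kleinLinear c v) +
      (((1 - ⟪c, x⟫) ^ 2)⁻¹ * ⟪c, v⟫) • (c - kleinLinear c x) := by
  rw [kleinDeriv, LinearMap.smul_apply, LinearMap.comp_apply, LinearMap.transvection.apply,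
    LinearMap.smul_apply, innerₗ_apply_apply, map_add, map_smul, map_sub, kleinLinear_self hc,
    smul_eq_mul, ← inv_pow]
  module

variable [FiniteDimensional ℝ E]

/-- The determinant is `s ^ (finrank - 1)` with `s = √(1 - ‖c‖ ^ 2)`; the extra factor avoids the
subtraction in the exponent. -/
theorem det_kleinLinear (hc : ‖c‖ < 1) :
    √(1 - ‖c‖ ^ 2) * LinearMap.det (kleinLinear c) = √(1 - ‖c‖ ^ 2) ^ finrank ℝ E := by
  have hs := klein_sqrt_pos hc
  have h : kleinLinear c = √(1 - ‖c‖ ^ 2) • LinearMap.transvection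
      ((√(1 - ‖c‖ ^ 2))⁻¹ • (1 + √(1 - ‖c‖ ^ 2))⁻¹ • innerₗ E c) c := by
    ext x
    rw [kleinLinear_apply, LinearMap.smul_apply, LinearMap.transvection.apply, smul_add, smul_smul]
    congr 2
    simp only [LinearMap.smul_apply, innerₗ_apply_apply, smul_eq_mul]
    field_simp
  rw [h, LinearMap.det_smul, LinearMap.transvection.det]
  simp only [LinearMap.smul_apply, innerₗ_apply_apply, smul_eq_mul, real_inner_self_eq_norm_sq]
  nth_rewrite 5 [klein_norm_sq hc]
  field_simp
  ring

theorem hasFDerivAt_kleinInvolution (hc : ‖c‖ < 1) {x : E} (hx : ‖x‖ < 1) :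
    HasFDerivAt (kleinInvolution c) (LinearMap.toContinuousLinearMap (kleinDeriv c x)) x := by
  have h1 := one_sub_inner_pos_of_norm_lt_one hc hx
  have hD : HasFDerivAt (fun x : E => 1 - ⟪c, x⟫) (-(innerSL ℝ c)) x :=
    ((innerSL ℝ c).hasFDerivAt).const_sub 1
  have hA : HasFDerivAt (fun x : E => c - kleinLinear c x)
      (-(LinearMap.toContinuousLinearMap (kleinLinear c))) x :=
    ((LinearMap.toContinuousLinearMap (kleinLinear c)).hasFDerivAt).const_sub c
  have hI := (hasDerivAt_inv h1.ne').comp_hasFDerivAt x hD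
  refine (hI.smul hA).congr_fderiv ?_
  ext1 v
  simp [kleinDeriv_apply hc]

/-- The derivative is a scalar times `kleinLinear c` after a transvection, so its determinant is a
product of known factors. -/
theorem abs_det_kleinDeriv (hc : ‖c‖ < 1) {x : E} (hx : ‖x‖ < 1) :
    |LinearMap.det (kleinDeriv c x)| =
      (√(1 - ‖c‖ ^ 2) / (1 - ⟪c, x⟫)) ^ (finrank ℝ E + 1) := by
  have hs := klein_sqrt_pos hc
  have h1 := one_sub_inner_pos_of_norm_lt_one hc hx
  have hs2 := Real.sq_sqrt (show 0 ≤ 1 - ‖c‖ ^ 2 by nlinarith [norm_nonneg c])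
  have hA := det_kleinLinear hc
  rw [kleinDeriv, LinearMap.det_smul, LinearMap.det_comp, LinearMap.transvection.det]
  have h2 : 1 + (-(1 - ⟪c, x⟫)⁻¹ • innerₗ E c) (c - x) =
      √(1 - ‖c‖ ^ 2) ^ 2 / (1 - ⟪c, x⟫) := by
    rw [LinearMap.smul_apply, innerₗ_apply_apply, inner_sub_right, real_inner_self_eq_norm_sq,
      hs2, smul_eq_mul]
    field_simp
    ring
  have h3 : LinearMap.det (kleinLinear c) * (√(1 - ‖c‖ ^ 2) ^ 2 / (1 - ⟪c, x⟫)) =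
      √(1 - ‖c‖ ^ 2) ^ (finrank ℝ E + 1) / (1 - ⟪c, x⟫) := by
    rw [pow_succ _ (finrank ℝ E), ← hA]; ring
  rw [h2, h3, abs_mul, abs_pow, abs_neg, abs_of_pos (inv_pos.2 h1), abs_of_pos (by positivity),
    div_pow, pow_succ (1 - ⟪c, x⟫), inv_pow]
  field_simp

end KleinInvolution

theorem sameRay_pos_smul_pos_smul_iff {V : Type*} [AddCommGroup V] [Module ℝ V] {x y : V} {a b : ℝ}
    (ha : 0 < a) (hb : 0 < b) : SameRay ℝ (a • x) (b • y) ↔ SameRay ℝ x y := by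
  refine ⟨fun h => ?_, fun h => (h.pos_smul_left ha).pos_smul_right hb⟩
  have := (h.pos_smul_left (inv_pos.2 ha)).pos_smul_right (inv_pos.2 hb)
  rwa [inv_smul_smul₀ ha.ne', inv_smul_smul₀ hb.ne'] at this

/-! ### The hyperbolic case -/

namespace HypSpace

open Set Metric Module

variable {d : ℕ}

theorem coords_injective : Function.Injective (coords (d := d)) := fun _ _ h => HypSpace.ext h

theorem isometry_of_coshDist_eq {f : HypSpace d → HypSpace d}
    (hf : ∀ x y, coshDist (f x) (f y) = coshDist x y) : Isometry f :=
  Isometry.of_dist_eq fun x y => by rw [dist_def, dist_def, hf]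

/-- The centre of the ball model. -/
def origin : HypSpace d := ⟨0, by simp⟩

/-- The point reflection in the midpoint of the origin and `c`. -/
noncomputable def pointReflection (c x : HypSpace d) : HypSpace d :=
  ⟨kleinInvolution c.coords x.coords,
    norm_kleinInvolution_lt_one c.norm_coords_lt_one x.norm_coords_lt_one⟩

theorem coshDist_pointReflection (c x y : HypSpace d) :
    coshDist (pointReflection c x) (pointReflection c y) = coshDist x y := by
  have hc := one_sub_norm_sq_pos c
  have hx := one_sub_norm_sq_pos x
  have hy := one_sub_norm_sq_pos y
  have hcx := one_sub_inner_pos c x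
  have hcy := one_sub_inner_pos c y
  have h : ∀ z : HypSpace d, √(1 - ‖(pointReflection c z).coords‖ ^ 2) =
      √(1 - ‖c.coords‖ ^ 2) * √(1 - ‖z.coords‖ ^ 2) / (1 - ⟪c.coords, z.coords⟫) := fun z => by
    rw [pointReflection, one_sub_norm_kleinInvolution c.norm_coords_lt_one z.norm_coords_lt_one,
      Real.sqrt_div' _ (sq_nonneg _), Real.sqrt_sq (one_sub_inner_pos c z).le,
      Real.sqrt_mul hc.le]
  have hs := Real.sqrt_pos.2 hc
  have hsx := Real.sqrt_pos.2 hx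
  have hsy := Real.sqrt_pos.2 hy
  have hs2 := Real.sq_sqrt hc.le
  rw [coshDist, coshDist, h, h, pointReflection, pointReflection,
    one_sub_inner_kleinInvolution c.norm_coords_lt_one x.norm_coords_lt_one y.norm_coords_lt_one]
  nth_rewrite 1 [← hs2]
  field_simp

theorem pointReflection_involutive (c : HypSpace d) : Function.Involutive (pointReflection c) :=
  fun x => HypSpace.ext
    (kleinInvolution_kleinInvolution c.norm_coords_lt_one x.norm_coords_lt_one)

/-- The point reflection in the midpoint of the origin and `c`, as an isometry. -/
noncomputable def pointReflectionIsometry (c : HypSpace d) : HypSpace d ≃ᵢ HypSpace d :=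
  ⟨(pointReflection_involutive c).toPerm, isometry_of_coshDist_eq (coshDist_pointReflection c)⟩

/-- The isometry of hyperbolic space given by a linear isometry of the ambient space. -/
noncomputable def linearIsometry (L : EuclideanSpace ℝ (Fin d) ≃ₗᵢ[ℝ] EuclideanSpace ℝ (Fin d)) :
    HypSpace d ≃ᵢ HypSpace d where
  toFun x := ⟨L x.coords, by rw [L.norm_map]; exact x.norm_coords_lt_one⟩
  invFun x := ⟨L.symm x.coords, by rw [L.symm.norm_map]; exact x.norm_coords_lt_one⟩
  left_inv x := HypSpace.ext (L.symm_apply_apply _)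
  right_inv x := HypSpace.ext (L.apply_symm_apply _)
  isometry_toFun := isometry_of_coshDist_eq fun x y => by
    simp only [coshDist, L.norm_map, L.inner_map_map]

/-- After the addition formula for `cosh`, additivity of distances through the origin is the
equality case of Cauchy–Schwarz for `-u` and `v`. -/
theorem dist_add_dist_origin_iff (u v : HypSpace d) :
    dist u origin + dist origin v = dist u v ↔ SameRay ℝ (-u.coords) v.coords := by
  have hu := one_sub_norm_sq_pos u
  have hv := one_sub_norm_sq_pos v
  have hsu := Real.sqrt_pos.2 hu
  have hsv := Real.sqrt_pos.2 hv
  have hcosh : ∀ w : HypSpace d, coshDist w origin = 1 / √(1 - ‖w.coords‖ ^ 2) := fun w => by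
    simp [coshDist, origin]
  have hsinh : ∀ w : HypSpace d,
      √(coshDist w origin ^ 2 - 1) = ‖w.coords‖ / √(1 - ‖w.coords‖ ^ 2) := fun w => by
    have hw := one_sub_norm_sq_pos w
    rw [hcosh, div_pow, Real.sq_sqrt hw.le, one_pow, div_sub_one hw.ne', Real.sqrt_div' _ hw.le,
      sub_sub_cancel, Real.sqrt_sq (norm_nonneg _)]
  rw [dist_comm origin v, ← Real.cosh_injOn.eq_iff
    (show dist u origin + dist v origin ∈ Ici 0 from add_nonneg dist_nonneg dist_nonneg)
    (show dist u v ∈ Ici 0 from dist_nonneg), Real.cosh_add, dist_def, dist_def, dist_def,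
    Real.cosh_arcosh (one_le_coshDist _ _), Real.cosh_arcosh (one_le_coshDist _ _),
    Real.cosh_arcosh (one_le_coshDist _ _), Real.sinh_arcosh (one_le_coshDist _ _),
    Real.sinh_arcosh (one_le_coshDist _ _), hsinh, hsinh, hcosh, hcosh, coshDist,
    div_mul_div_comm, div_mul_div_comm, ← add_div, div_left_inj' (by positivity),
    sameRay_iff_norm_smul_eq, eq_comm (a := ‖-u.coords‖ • v.coords), ← inner_eq_norm_mul_iff_real,
    norm_neg, inner_neg_left]
  constructor <;> intro h <;> linarith

/-- The reflection exchanging `x` and the origin reduces the claim to segments through the origin.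
It takes each `y` to a positive multiple of an injective linear image of `x - y`, so it respects the
same-ray condition. -/
theorem geodesicSegment_eq (p q : HypSpace d) :
    geodesicSegment p q = coords ⁻¹' segment ℝ p.coords q.coords := by
  ext x
  have hx := x.norm_coords_lt_one
  have hxx : pointReflection x x = origin :=
    HypSpace.ext (kleinInvolution_self hx)
  have hdist : ∀ y z, dist (pointReflection x y) (pointReflection x z) = dist y z := fun y z => by
    rw [dist_def, dist_def, coshDist_pointReflection]
  have hcoords : ∀ y, (pointReflection x y).coords =
      (1 - ⟪x.coords, y.coords⟫)⁻¹ • kleinLinear x.coords (x.coords - y.coords) :=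
    fun y => kleinInvolution_eq_smul hx _
  change dist p x + dist x q = dist p q ↔ _
  rw [← hdist p x, ← hdist x q, ← hdist p q, hxx, dist_add_dist_origin_iff, mem_preimage,
    mem_segment_iff_sameRay, hcoords, hcoords, ← smul_neg, ← map_neg, neg_sub,
    sameRay_pos_smul_pos_smul_iff (inv_pos.2 (one_sub_inner_pos x p))
      (inv_pos.2 (one_sub_inner_pos x q)),
    (kleinLinear_injective hx).sameRay_map_iff, ← sameRay_neg_iff, neg_sub, neg_sub]

theorem geodesicHull_eq (X : Set (HypSpace d)) :
    geodesicHull X = coords ⁻¹' convexHull ℝ (coords '' X) := by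
  apply Subset.antisymm
  · refine sInter_subset_of_mem ⟨fun p hp q hq => ?_, fun x hx => ?_⟩
    · rw [geodesicSegment_eq]
      exact preimage_mono ((convex_convexHull ℝ _).segment_subset hp hq)
    · exact subset_convexHull ℝ _ ⟨x, hx, rfl⟩
  · rintro x hx K ⟨hK, hX⟩
    have hconv : Convex ℝ (coords '' K) := by
      rw [convex_iff_segment_subset]
      rintro _ ⟨p, hp, rfl⟩ _ ⟨q, hq, rfl⟩ y hy
      have hy1 : ‖y‖ < 1 := by
        have := (convex_ball (0 : EuclideanSpace ℝ (Fin d)) 1).segment_subset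
          (by simpa using p.norm_coords_lt_one) (by simpa using q.norm_coords_lt_one) hy
        simpa using this
      exact ⟨⟨y, hy1⟩, hK p hp q hq (by rw [geodesicSegment_eq]; exact hy), rfl⟩
    obtain ⟨y, hy, hyx⟩ := convexHull_min (image_mono hX) hconv hx
    rwa [← coords_injective hyx]

theorem simplexBody_eq (p : Fin (d + 1) → HypSpace d) :
    simplexBody p = coords ⁻¹' convexHull ℝ (range (coords ∘ p)) := by
  rw [simplexBody, geodesicHull_eq, range_comp]

theorem simplexFacet_eq (p : Fin (d + 1) → HypSpace d) (i : Fin (d + 1)) :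
    simplexFacet p i = coords ⁻¹' convexHull ℝ ((coords ∘ p) '' {j | j ≠ i}) := by
  rw [simplexFacet, geodesicHull_eq, image_comp]

theorem mem_closedBall_origin {r : ℝ} {x : HypSpace d} :
    x ∈ closedBall origin r ↔ ‖x.coords‖ ≤ Real.tanh r := by
  have hx := one_sub_norm_sq_pos x
  have hnorm : ‖x.coords‖ = Real.tanh (dist x origin) := by
    have hcosh : coshDist x origin = 1 / √(1 - ‖x.coords‖ ^ 2) := by simp [coshDist, origin]
    have hs := Real.sqrt_pos.2 hx
    rw [dist_def, Real.tanh_arcosh (one_le_coshDist _ _), hcosh, div_pow, Real.sq_sqrt hx.le,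
      one_pow, div_sub_one hx.ne', Real.sqrt_div' _ hx.le, sub_sub_cancel,
      Real.sqrt_sq (norm_nonneg _)]
    field_simp
  -- Clearing denominators turns the comparison of `tanh` into `sinh (dist x origin - r) ≤ 0`.
  rw [mem_closedBall, hnorm, Real.tanh_eq_sinh_div_cosh, Real.tanh_eq_sinh_div_cosh,
    div_le_div_iff₀ (Real.cosh_pos _) (Real.cosh_pos _), ← sub_nonpos, ← Real.sinh_nonpos_iff,
    Real.sinh_sub, sub_nonpos, mul_comm (Real.cosh (dist x origin))]

theorem closedBall_origin_subset_iff {r : ℝ} {S : Set (EuclideanSpace ℝ (Fin d))} :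
    closedBall origin r ⊆ coords ⁻¹' S ↔ closedBall 0 (Real.tanh r) ⊆ S := by
  constructor
  · intro h y hy
    rw [mem_closedBall_zero_iff] at hy
    exact h (a := ⟨y, hy.trans_lt (Real.tanh_lt_one r)⟩) (mem_closedBall_origin.2 hy)
  · intro h x hx
    exact h (by rw [mem_closedBall_zero_iff]; exact mem_closedBall_origin.1 hx)

/-- The density of the hyperbolic volume, extended by `∞` outside the ball model. -/
noncomputable def density (d : ℕ) (t : ℝ) : ℝ≥0∞ :=
  if t < 1 then ENNReal.ofReal ((1 - max t 0 ^ 2) ^ (-((d : ℝ) + 1) / 2)) else ∞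

theorem monotone_density (d : ℕ) : Monotone (density d) := by
  intro s t hst
  rw [density, density]
  split_ifs with hs ht
  · apply ENNReal.ofReal_le_ofReal
    have h0 : 0 ≤ max s 0 := le_max_right _ _
    have h1 : max s 0 ≤ max t 0 := max_le_max_right 0 hst
    have h2 : max t 0 < 1 := max_lt ht one_pos
    refine Real.rpow_le_rpow_of_nonpos (by nlinarith) (by nlinarith) ?_
    have : (0 : ℝ) ≤ d := Nat.cast_nonneg d
    linarith
  · exact le_top
  · linarith
  · exact le_rfl

theorem density_zero_ne_zero (d : ℕ) : density d 0 ≠ 0 := by simp [density]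

theorem density_ne_top {t : ℝ} (ht : t < 1) : density d t ≠ ∞ := by simp [density, ht]

theorem density_norm {x : EuclideanSpace ℝ (Fin d)} (hx : ‖x‖ < 1) :
    density d ‖x‖ = ENNReal.ofReal ((1 - ‖x‖ ^ 2) ^ (-((d : ℝ) + 1) / 2)) := by
  rw [density, if_pos hx, max_eq_left (norm_nonneg x)]

theorem convexHull_coords_subset_ball (p : Fin (d + 1) → HypSpace d) :
    convexHull ℝ (range (coords ∘ p)) ⊆ ball 0 1 := by
  refine convexHull_min ?_ (convex_ball _ _)
  rintro _ ⟨i, rfl⟩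
  simpa using (p i).norm_coords_lt_one

theorem image_coords_simplexBody (p : Fin (d + 1) → HypSpace d) :
    coords '' simplexBody p = convexHull ℝ (range (coords ∘ p)) := by
  rw [simplexBody_eq, image_preimage_eq_of_subset]
  exact fun x hx => ⟨⟨x, by simpa using convexHull_coords_subset_ball p hx⟩, rfl⟩

theorem measurableSet_simplexBody (p : Fin (d + 1) → HypSpace d) :
    MeasurableSet (simplexBody p) := by
  rw [simplexBody_eq]
  exact ⟨_, (isCompact_convexHull_range _).measurableSet, rfl⟩

theorem volume_simplexBody (p : Fin (d + 1) → HypSpace d) :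
    volume (simplexBody p) = radialMeasure (density d) (convexHull ℝ (range (coords ∘ p))) := by
  have hm := (isCompact_convexHull_range (coords ∘ p)).measurableSet
  rw [volume_eq_lintegral _ (measurableSet_simplexBody p), image_coords_simplexBody,
    radialMeasure, withDensity_apply _ hm]
  exact setLIntegral_congr_fun hm fun x hx =>
    (density_norm (by simpa using convexHull_coords_subset_ball p hx)).symm

/-- With `k = √(1 - ‖c‖ ^ 2) / (1 - ⟪c, x⟫)`, the Jacobian is `k ^ (d + 1)` and `1 - ‖x‖ ^ 2` is
multiplied by `k ^ 2`, so the exponent `-(d + 1) / 2` of the density cancels the Jacobian exactly.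
-/
theorem volume_pointReflection_simplexBody (c : HypSpace d) (p : Fin (d + 1) → HypSpace d) :
    volume (simplexBody (pointReflectionIsometry c ∘ p)) = volume (simplexBody p) := by
  have hc := c.norm_coords_lt_one
  have himg : coords '' simplexBody (pointReflectionIsometry c ∘ p) =
      kleinInvolution c.coords '' (coords '' simplexBody p) := by
    rw [IsometryEquiv.simplexBody_comp, image_image, image_image]
    rfl
  have hsub : ∀ x ∈ coords '' simplexBody p, ‖x‖ < 1 := by
    rintro _ ⟨x, -, rfl⟩
    exact x.norm_coords_lt_one
  have hm : MeasurableSet (coords '' simplexBody p) := by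
    rw [image_coords_simplexBody]
    exact (isCompact_convexHull_range _).measurableSet
  have hinj : InjOn (kleinInvolution c.coords) (coords '' simplexBody p) := by
    intro x hx y hy hxy
    rw [← kleinInvolution_kleinInvolution hc (hsub x hx), hxy,
      kleinInvolution_kleinInvolution hc (hsub y hy)]
  rw [volume_eq_lintegral _ (measurableSet_simplexBody _),
    volume_eq_lintegral _ (measurableSet_simplexBody _), himg,
    lintegral_image_eq_lintegral_abs_det_fderiv_mul volume hm
      (fun x hx => (hasFDerivAt_kleinInvolution hc (hsub x hx)).hasFDerivWithinAt) hinj]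
  refine setLIntegral_congr_fun hm fun x hx => ?_
  have hx1 := hsub x hx
  have hcx := one_sub_inner_pos_of_norm_lt_one hc hx1
  have hN : 0 < 1 - ‖x‖ ^ 2 := by nlinarith [norm_nonneg x]
  have hs := klein_sqrt_pos hc
  have hs2 := Real.sq_sqrt (one_sub_norm_sq_pos c).le
  have hk : 0 < √(1 - ‖c.coords‖ ^ 2) / (1 - ⟪c.coords, x⟫) := by positivity
  change ENNReal.ofReal |LinearMap.det (kleinDeriv c.coords x)| * _ = _
  rw [abs_det_kleinDeriv hc hx1, ← ENNReal.ofReal_mul (by positivity)]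
  congr 1
  have hE : 1 - ‖kleinInvolution c.coords x‖ ^ 2 =
      (√(1 - ‖c.coords‖ ^ 2) / (1 - ⟪c.coords, x⟫)) ^ 2 * (1 - ‖x‖ ^ 2) := by
    rw [one_sub_norm_kleinInvolution hc hx1, div_pow, hs2]
    ring
  generalize √(1 - ‖c.coords‖ ^ 2) / (1 - ⟪c.coords, x⟫) = k at hE hk ⊢
  rw [hE, finrank_euclideanSpace, Fintype.card_fin, Real.mul_rpow (by positivity) hN.le,
    ← mul_assoc, ← Real.rpow_natCast k (d + 1), ← Real.rpow_natCast k 2, ← Real.rpow_mul hk.le,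
    ← Real.rpow_add hk]
  rw [show ((d + 1 : ℕ) : ℝ) + ((2 : ℕ) : ℝ) * (-((d : ℝ) + 1) / 2) = 0 by push_cast; ring,
    Real.rpow_zero, one_mul]

theorem isSimplex_of_closedBall_subset {c : HypSpace d} {r : ℝ} (hr : 0 < r)
    {p : Fin (d + 1) → HypSpace d} (hp : closedBall c r ⊆ simplexBody p) : IsSimplex p :=
  ⟨c, mem_interior.2 ⟨ball c r, ball_subset_closedBall.trans hp, isOpen_ball, mem_ball_self hr⟩⟩

theorem exists_norm_le_lt_one (p : Fin (d + 1) → HypSpace d) :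
    ∃ R < 1, ∀ i, ‖(coords ∘ p) i‖ ≤ R := by
  obtain ⟨i, hi⟩ := Finite.exists_max fun i => ‖(p i).coords‖
  exact ⟨_, (p i).norm_coords_lt_one, hi⟩

theorem volume_simplexBody_ne_top (p : Fin (d + 1) → HypSpace d) :
    volume (simplexBody p) ≠ ∞ := by
  obtain ⟨R, hR1, hR⟩ := exists_norm_le_lt_one p
  have hcomp := isCompact_convexHull_range (coords ∘ p)
  have hsub : convexHull ℝ (range (coords ∘ p)) ⊆ closedBall 0 R := by
    refine convexHull_min ?_ (convex_closedBall _ _)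
    rintro _ ⟨i, rfl⟩
    simpa using hR i
  rw [volume_simplexBody, radialMeasure, withDensity_apply _ hcomp.measurableSet]
  have hle : ∫⁻ x in convexHull ℝ (range (coords ∘ p)), density d ‖x‖ ≤
      density d R * volume (convexHull ℝ (range (coords ∘ p))) := by
    rw [← setLIntegral_const]
    exact setLIntegral_mono measurable_const fun x hx =>
      monotone_density d (by simpa using hsub hx)
  exact ne_top_of_le_ne_top
    (ENNReal.mul_ne_top (density_ne_top hR1) hcomp.measure_lt_top.ne) hle

theorem minVol_centered (hd : 1 ≤ d) {r : ℝ} (hr : 0 < r) :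
    ((∃ q : Fin (d + 1) → HypSpace d, IsSimplex q ∧ closedBall origin r ⊆ simplexBody q) →
      ∃ p : Fin (d + 1) → HypSpace d, IsMinVolSimplexContaining volume p (closedBall origin r)) ∧
    ∀ p : Fin (d + 1) → HypSpace d,
      IsMinVolSimplexContaining volume p (closedBall origin r) ↔
        IsRegularSimplex p ∧ IsCircumscribedAbout p (closedBall origin r) := by
  have hdim : finrank ℝ (EuclideanSpace ℝ (Fin d)) = d := by simp
  have hcard : Fintype.card (Fin (d + 1)) = d + 1 := by simp
  have hφ := monotone_density d
  have h0 := density_zero_ne_zero d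
  set ρ := Real.tanh r with hρdef
  have hρ : 0 < ρ := by
    rw [hρdef, Real.tanh_eq_sinh_div_cosh]
    exact div_pos (Real.sinh_pos_iff.2 hr) (Real.cosh_pos r)
  have hρ1 : ρ < 1 := Real.tanh_lt_one r
  have hball : ∀ p : Fin (d + 1) → HypSpace d, closedBall origin r ⊆ simplexBody p ↔
      closedBall 0 ρ ⊆ convexHull ℝ (range (coords ∘ p)) := fun p => by
    rw [simplexBody_eq, closedBall_origin_subset_iff]
  have hfin : ∀ p : Fin (d + 1) → HypSpace d,
      radialMeasure (density d) (convexHull ℝ (range (coords ∘ p))) ≠ ∞ := fun p => by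
    rw [← volume_simplexBody]
    exact volume_simplexBody_ne_top p
  have hmin : ∀ p : Fin (d + 1) → HypSpace d,
      closedBall 0 ρ ⊆ convexHull ℝ (range (coords ∘ p)) →
      (∀ i j, ⟪(coords ∘ p) i, (coords ∘ p) j⟫ = if i = j then (d * ρ) ^ 2 else -(d * ρ ^ 2)) →
      IsMinVolSimplexContaining volume p (closedBall origin r) := by
    intro p hp hinner
    have hp' := (hball p).2 hp
    refine ⟨isSimplex_of_closedBall_subset hr hp', hp', fun q _ hq => ?_⟩
    rw [volume_simplexBody, volume_simplexBody]
    exact radialMeasure_le_of_inner_eq hd hdim hcard hφ h0 hρ hp hinner ((hball q).1 hq)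
  have hlift : ∀ q : Fin (d + 1) → EuclideanSpace ℝ (Fin d), (∀ i, ‖q i‖ < 1) →
      ∃ p : Fin (d + 1) → HypSpace d, coords ∘ p = q :=
    fun q hq => ⟨fun i => ⟨q i, hq i⟩, rfl⟩
  refine ⟨?_, fun p => ⟨fun hp => ?_, fun ⟨hreg, hcirc⟩ => ?_⟩⟩
  · rintro ⟨q, -, hq⟩
    obtain ⟨R, hR1, hR⟩ := exists_norm_le_lt_one q
    -- The minimizer competes only against vertices of norm at most `R < 1`, but its Gram matrix
    -- does not involve `R`, so `hmin` yields minimality among all simplices.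
    obtain ⟨m, hm⟩ := exists_isRadialMin (φ := density d) hρ ⟨coords ∘ q, (hball q).1 hq, hR⟩
    obtain ⟨p, rfl⟩ := hlift m fun i => (hm.norm_le i).trans_lt hR1
    exact ⟨p, hmin p hm.ball_subset (hm.inner_eq hd hdim hcard hφ h0 hρ (hfin p))⟩
  · have hpB := (hball p).1 hp.2.1
    obtain ⟨R, hR1, hR⟩ := exists_norm_le_lt_one p
    have hrad : IsRadialMin (density d) R ρ (coords ∘ p) := ⟨hpB, hR, fun q hq hqR => by
      obtain ⟨q, rfl⟩ := hlift q fun i => (hqR i).trans_lt hR1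
      have hq' := (hball q).2 hq
      rw [← volume_simplexBody, ← volume_simplexBody]
      exact hp.2.2 q (isSimplex_of_closedBall_subset hr hq') hq'⟩
    have hinner := hrad.inner_eq hd hdim hcard hφ h0 hρ (hfin p)
    refine ⟨⟨hp.1, fun σ => ?_⟩, hp.2.1, fun i => ?_⟩
    · obtain ⟨L, hL⟩ := exists_linearIsometryEquiv_perm hρ hpB hinner σ
      exact ⟨linearIsometry L, fun i => HypSpace.ext (hL i)⟩
    · have : Nontrivial (Fin (d + 1)) := Fin.nontrivial_iff_two_le.2 (by omega)
      obtain ⟨z, hz, hz'⟩ := hrad.exists_mem_facet (by simp) hφ h0 hρ (hfin p) i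
      rw [mem_closedBall_zero_iff] at hz
      exact ⟨⟨z, hz.trans_lt hρ1⟩, by rw [simplexFacet_eq]; exact hz', mem_closedBall_origin.2 hz⟩
  · have hpB := (hball p).1 hcirc.1
    refine hmin p hpB ?_
    obtain ⟨a, ha⟩ := hreg.exists_dist_eq
    obtain ⟨b, hb⟩ := exists_affineBasis_of_ball_subset (by simp) hρ hpB
    have hbp : ∀ i, b i = (p i).coords := fun i => congrFun hb i
    rw [← hb] at hpB ⊢
    have htouch : ∀ i, ∃ z ∈ closedBall (0 : EuclideanSpace ℝ (Fin d)) ρ, b.coord i z = 0 := by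
      intro i
      obtain ⟨z, hz, hzB⟩ := hcirc.2 i
      rw [simplexFacet_eq, ← hb] at hz
      exact ⟨z.coords, by rw [mem_closedBall_zero_iff]; exact mem_closedBall_origin.1 hzB,
        ((b.mem_convexHull_image_ne_iff i _).1 hz).2⟩
    have hs : ∀ i, 0 < √(1 - ‖(p i).coords‖ ^ 2) := fun i =>
      Real.sqrt_pos.2 (one_sub_norm_sq_pos (p i))
    have hcosh : ∀ i j, (√(1 - ‖(p i).coords‖ ^ 2))⁻¹ * (√(1 - ‖(p j).coords‖ ^ 2))⁻¹ *
        (1 - ⟪b i, b j⟫) = coshDist (p i) (p j) := fun i j => by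
      rw [coshDist, hbp, hbp, ← mul_inv, div_eq_inv_mul]
    have hne : ∀ i j, i ≠ j → (√(1 - ‖(p i).coords‖ ^ 2))⁻¹ * (√(1 - ‖(p j).coords‖ ^ 2))⁻¹ *
        (1 - ⟪b i, b j⟫) = Real.cosh a := fun i j hij => by
      rw [hcosh, ← ha i j hij, dist_def, Real.cosh_arcosh (one_le_coshDist _ _)]
    -- The Lorentz product of two vertices lifted to the hyperboloid is the `cosh` of their
    -- distance, so regularity makes these products constant.
    have hγ := b.norm_eq_of_lorentz_eq_of_touch hcard hρ hρ1 (Real.one_le_cosh a)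
      (γ := fun i => (√(1 - ‖(p i).coords‖ ^ 2))⁻¹) (fun i => inv_pos.2 (hs i))
      (fun i => by rw [hcosh, coshDist_self]) hne hpB htouch
    refine b.inner_eq_of_balanced hd hcard hρ hpB (fun i j => ?_) (fun i j k hki hkj => ?_)
      ⟨0, htouch 0⟩
    · have h := inv_injective (hγ i j)
      rw [Real.sqrt_inj (one_sub_norm_sq_pos _).le (one_sub_norm_sq_pos _).le] at h
      rw [hbp, hbp, ← sq_eq_sq₀ (norm_nonneg _) (norm_nonneg _)]
      linarith
    · have h1 := hne k i hki
      rw [← hne k j hkj] at h1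
      have h2 : (√(1 - ‖(p j).coords‖ ^ 2))⁻¹ = (√(1 - ‖(p i).coords‖ ^ 2))⁻¹ := hγ j i
      rw [h2] at h1
      have h3 := mul_left_cancel₀
        (mul_pos (inv_pos.2 (hs k)) (inv_pos.2 (hs i))).ne' h1
      linarith

theorem minVol (hd : 1 ≤ d) (c : HypSpace d) {r : ℝ} (hr : 0 < r) :
    ((∃ q : Fin (d + 1) → HypSpace d, IsSimplex q ∧ closedBall c r ⊆ simplexBody q) →
      ∃ p : Fin (d + 1) → HypSpace d, IsMinVolSimplexContaining volume p (closedBall c r)) ∧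
    ∀ p : Fin (d + 1) → HypSpace d,
      IsMinVolSimplexContaining volume p (closedBall c r) ↔
        IsRegularSimplex p ∧ IsCircumscribedAbout p (closedBall c r) := by
  obtain ⟨hex, hiff⟩ := minVol_centered hd hr
  set e := pointReflectionIsometry c with he
  have hB : e '' closedBall origin r = closedBall c r := by
    rw [e.image_closedBall]
    congr 1
    exact HypSpace.ext (kleinInvolution_zero c.coords)
  have hμ : ∀ q : Fin (d + 1) → HypSpace d,
      volume (simplexBody (e ∘ q)) = volume (simplexBody q) :=
    volume_pointReflection_simplexBody c
  refine ⟨?_, minVol_iff_regular_of_image e hμ hB hiff⟩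
  rintro ⟨q, hq, hqB⟩
  obtain ⟨p, hp⟩ := hex ⟨e.symm ∘ q, hq.comp e.symm, by
    rw [e.symm.simplexBody_comp]
    intro x hx
    exact ⟨e x, hqB (hB ▸ mem_image_of_mem e hx), e.symm_apply_apply x⟩⟩
  exact ⟨e ∘ p, hB ▸ hp.comp e hμ⟩

end HypSpace

theorem mainTheorem3 (d : ℕ) (hd : 1 ≤ d) :
    (∀ (c : EuclideanSpace ℝ (Fin d)) (r : ℝ), 0 < r →
      (∃ p : Fin (d + 1) → EuclideanSpace ℝ (Fin d),
        IsMinVolSimplexContaining MeasureTheory.volume p (Metric.closedBall c r)) ∧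
      ∀ p : Fin (d + 1) → EuclideanSpace ℝ (Fin d),
        IsMinVolSimplexContaining MeasureTheory.volume p (Metric.closedBall c r) ↔
          IsRegularSimplex p ∧ IsCircumscribedAbout p (Metric.closedBall c r)) ∧
    (∀ (c : HypSpace d) (r : ℝ), 0 < r →
      ((∃ q : Fin (d + 1) → HypSpace d,
          IsSimplex q ∧ Metric.closedBall c r ⊆ simplexBody q) →
        ∃ p : Fin (d + 1) → HypSpace d,
          IsMinVolSimplexContaining MeasureTheory.volume p (Metric.closedBall c r)) ∧
      ∀ p : Fin (d + 1) → HypSpace d,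
        IsMinVolSimplexContaining MeasureTheory.volume p (Metric.closedBall c r) ↔
          IsRegularSimplex p ∧ IsCircumscribedAbout p (Metric.closedBall c r)) :=
  ⟨fun c _ hr => euclidean_minVol hd c hr, fun c _ hr => HypSpace.minVol hd c hr⟩
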